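/- Let $n\ge 1$, let $\mathbb H$ be the quaternions, and write points of $\mathbb H^n$ as $q=(q_1,q')$ with $q'=(q_2,\dots,q_n)\in\mathbb H^{n-1}$. Let $$\mathcal U_n=\{q\in\mathbb H^n:\ \operatorname{Re}q_1>|q'|^2\},\qquad \partial\mathcal U_n=\{q\in\mathbb H^n:\ \operatorname{Re}q_1=|q'|^2\},$$ and let $d\beta$ be the measure on $\partial\mathcal U_n$ that corresponds to Lebesgue measure on $\operatorname{Im}\mathbb H\times\mathbb H^{n-1}\cong\mathbb R^3\times\mathbb R^{4(n-1)}$ under $(q_1,q')\mapsto(\operatorname{Im}q_1,q')$. Write $q_l=x_{4l-3}+x_{4l-2}\mathbf i+x_{4l-1}\mathbf j+x_{4l}\mathbf k$. A $C^1$ function $F:\mathcal U_n\to\mathbb H$ is (left) regular if $\partial_{x_{4l-3}}F+\mathbf i\,\partial_{x_{4l-2}}F+\mathbf j\,\partial_{x_{4l-1}}F+\mathbf k\,\partial_{x_{4l}}F=0$ on $\mathcal U_n$ for $l=1,\dots,n$. For $\varepsilon>0$ put $F_\varepsilon(q)=F(q+\varepsilon\mathbf e)$ with $\mathbf e=(1,0,\dots,0)$.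 The Hardy space $H^2(\mathcal U_n)$ consists of all regular $F$ on $\mathcal U_n$ with $\sup_{\varepsilon>0}\int_{\partial\mathcal U_n}|F_\varepsilon|^2\,d\beta<\infty$. A function $F^b\in L^2(\partial\mathcal U_n,d\beta)$ is called the boundary value of $F$ if $F_\varepsilon\to F^b$ in $L^2(\partial\mathcal U_n,d\beta)$ as $\varepsilon\to0^+$. **Theorem.** Every $F\in H^2(\mathcal U_n)$ has a boundary value $F^b$, unique up to $\beta$-almost everywhere equality, and $H^2(\mathcal U_n)\ne\{0\}$. There is a unique function $S:\mathcal U_n\times\mathcal U_n\to\mathbb H$ (the Cauchy–Szegő kernel) such that: 1. for each $p\in\mathcal U_n$, the function $q\mapsto S(q,p)$ is regular on $\mathcal U_n$ and belongs to $H^2(\mathcal U_n)$; in particular it has a boundary value $S^b(\cdot,p)$; 2. $S(q,p)=\overline{S(p,q)}$ for all $p,q\in\mathcal U_n$; consequently, for each $q\in\mathcal U_n$ the function $p\mapsto S(q,p)$ has a boundary value $S_b(q,\cdot)\in L^2(\partial\mathcal U_n,d\beta)$, in the same sense of $L^2$-convergence of vertical translates; 3. for every $F\in H^2(\mathcal U_n)$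 and every $q\in\mathcal U_n$, the function $Q\mapsto S_b(q,Q)F^b(Q)$ is $\beta$-integrable and $$F(q)=\int_{\partial\mathcal U_n}S_b(q,Q)\,F^b(Q)\,d\beta(Q).$$ -/

import Mathlib

open MeasureTheory Filter Topology
open scoped Quaternion ENNReal

noncomputable section

namespace QuatSiegel

instance instMeasurableSpaceQuaternion : MeasurableSpace ℍ := borel ℍ

instance instBorelSpaceQuaternion : BorelSpace ℍ := ⟨rfl⟩

/-- The quaternionic space `ℍ^n` with `n = m + 1`. A point is `q = (q_1, q')`, where `q_1` is
`q 0` and the components of `q' ∈ ℍ^(n-1)` are `q l.succ` for `l : Fin m`. -/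
abbrev HVec (m : ℕ) : Type := Fin (m + 1) → ℍ

/-- `|q'|^2`, where `q = (q_1, q')`. -/
def tailNormSq {m : ℕ} (q : HVec m) : ℝ := ∑ l : Fin m, ‖q l.succ‖ ^ 2

/-- The quaternionic Siegel upper half space `U_n = {Re q_1 > |q'|^2}`, `n = m + 1`. -/
def siegel (m : ℕ) : Set (HVec m) := {q | tailNormSq q < (q 0).re}

/-- The hypersurface `∂U_n = {Re q_1 = |q'|^2}`. -/
def siegelBoundary (m : ℕ) : Set (HVec m) := {q | (q 0).re = tailNormSq q}

/-- The quaternion `a + b i + c j + d k`. -/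
def quat (a b c d : ℝ) : ℍ := ⟨a, b, c, d⟩

@[simp] theorem quat_re (a b c d : ℝ) : (quat a b c d).re = a := rfl

@[simp] theorem quat_imI (a b c d : ℝ) : (quat a b c d).imI = b := rfl

@[simp] theorem quat_imJ (a b c d : ℝ) : (quat a b c d).imJ = c := rfl

@[simp] theorem quat_imK (a b c d : ℝ) : (quat a b c d).imK = d := rfl

/-- The Cauchy-Fueter operator
`∂_{x_1} + i ∂_{x_2} + j ∂_{x_3} + k ∂_{x_4}` in the quaternionic variable number `l`. -/
def cauchyFueter {m : ℕ} (l : Fin (m + 1)) (f : HVec m → ℍ) (q : HVec m) : ℍ :=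
  fderiv ℝ f q (Pi.single l 1)
    + quat 0 1 0 0 * fderiv ℝ f q (Pi.single l (quat 0 1 0 0))
    + quat 0 0 1 0 * fderiv ℝ f q (Pi.single l (quat 0 0 1 0))
    + quat 0 0 0 1 * fderiv ℝ f q (Pi.single l (quat 0 0 0 1))

/-- (Left) regular functions on a set `D` (used for open `D`): `C^1` functions satisfying the
Cauchy-Fueter equations in each variable. -/
def IsRegularOn {m : ℕ} (f : HVec m → ℍ) (D : Set (HVec m)) : Prop :=
  ContDiffOn ℝ 1 f D ∧ ∀ l : Fin (m + 1), ∀ q ∈ D, cauchyFueter l f q = 0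

/-- The quaternion with the real coordinates `x`. -/
def ofCoords (x : Fin 4 → ℝ) : ℍ := quat (x 0) (x 1) (x 2) (x 3)

/-- The inverse of the projection from `∂U_n` to the Heisenberg group `Im ℍ × ℍ^(n-1)`, written
in real coordinates:
`(x_2 i + x_3 j + x_4 k, q') ↦ (|q'|^2 + x_2 i + x_3 j + x_4 k, q')`. -/
def boundaryParam (m : ℕ) (v : (Fin 3 → ℝ) × (Fin m → Fin 4 → ℝ)) : HVec m :=
  Fin.cons (quat (∑ l : Fin m, ‖ofCoords (v.2 l)‖ ^ 2) (v.1 0) (v.1 1) (v.1 2))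
    (fun l => ofCoords (v.2 l))

/-- The measure `dβ` on `∂U_n`: Lebesgue measure of `ℝ^3 × ℝ^(4(n-1))` (a Haar measure of the
Heisenberg group) transported by the projection. -/
def beta (m : ℕ) : Measure (HVec m) := Measure.map (boundaryParam m) volume

theorem continuous_quat {X : Type*} [TopologicalSpace X] {a b c d : X → ℝ} (ha : Continuous a)
    (hb : Continuous b) (hc : Continuous c) (hd : Continuous d) :
    Continuous fun x => quat (a x) (b x) (c x) (d x) := by
  have h : Continuous fun x =>
      Quaternion.linearIsometryEquivTuple.symm (WithLp.toLp 2 ![a x, b x, c x, d x]) := by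
    refine Quaternion.linearIsometryEquivTuple.symm.continuous.comp ?_
    refine (PiLp.continuous_toLp 2 _).comp ?_
    refine continuous_pi fun i => ?_
    fin_cases i <;> simp <;> assumption
  exact h

theorem continuous_ofCoords : Continuous ofCoords :=
  continuous_quat (by fun_prop) (by fun_prop) (by fun_prop) (by fun_prop)

theorem continuous_boundaryParam (m : ℕ) : Continuous (boundaryParam m) := by
  refine continuous_pi fun i => ?_
  refine Fin.cases ?_ (fun l => ?_) i
  · refine continuous_quat ?_ (by fun_prop) (by fun_prop) (by fun_prop)
    refine continuous_finsetSum _ fun l _ => ?_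
    exact ((continuous_ofCoords.comp (by fun_prop)).norm).pow 2
  · exact continuous_ofCoords.comp (by fun_prop)

theorem measurable_boundaryParam (m : ℕ) : Measurable (boundaryParam m) :=
  measurable_pi_iff.2 fun i => ((continuous_apply i).comp (continuous_boundaryParam m)).measurable

theorem boundaryParam_mem (m : ℕ) (v : (Fin 3 → ℝ) × (Fin m → Fin 4 → ℝ)) :
    boundaryParam m v ∈ siegelBoundary m := by
  rfl

/-- The vertical translate `F_ε(q) = F(q + ε e)` with `e = (1, 0, …, 0)`. -/
def vertTranslate {m : ℕ} (F : HVec m → ℍ) (ε : ℝ) (q : HVec m) : ℍ :=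
  F (q + Pi.single 0 (ε : ℍ))

/-- The Hardy space `H^2(U_n)`: functions regular on `U_n` with
`sup_{ε > 0} ∫_{∂U_n} |F_ε|^2 dβ < ∞`. Only the values of `F` on `U_n` matter. -/
def MemHardy {m : ℕ} (F : HVec m → ℍ) : Prop :=
  IsRegularOn F (siegel m) ∧
    (⨆ (ε : ℝ) (_ : 0 < ε), ∫⁻ q, ‖vertTranslate F ε q‖ₑ ^ 2 ∂(beta m)) < ∞

/-- `g ∈ L^2(∂U_n)` is the boundary value of `F`: `F_ε → g` in `L^2(∂U_n)` as `ε → 0+`. -/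
def IsBoundaryValue {m : ℕ} (F g : HVec m → ℍ) : Prop :=
  MemLp g 2 (beta m) ∧
    Tendsto (fun ε : ℝ => eLpNorm (fun q => vertTranslate F ε q - g q) 2 (beta m))
      (𝓝[>] 0) (𝓝 0)

/-- The three conditions characterizing the Cauchy-Szegő kernel. Only the values of `S` on
`U_n × U_n` matter. In the last one, `Sb` is the boundary value of `S` in its second variable. -/
structure IsCauchySzegoKernel {m : ℕ} (S : HVec m → HVec m → ℍ) : Prop where
  mem_hardy : ∀ p ∈ siegel m, MemHardy (fun q => S q p)
  symm : ∀ q ∈ siegel m, ∀ p ∈ siegel m, S q p = star (S p q)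
  reproducing : ∀ F : HVec m → ℍ, MemHardy F → ∀ q ∈ siegel m, ∀ Fb Sb : HVec m → ℍ,
    IsBoundaryValue F Fb → IsBoundaryValue (fun p => S q p) Sb →
      Integrable (fun Q => Sb Q * Fb Q) (beta m) ∧ F q = ∫ Q, Sb Q * Fb Q ∂(beta m)

end QuatSiegel

end

open QuatSiegel

/-! Boundary values. Let `F_t` be the restriction of `F` to the level of height `t`. The
Cauchy–Fueter equation in `q_1` reads `∂_t F_t = -D F_t`, where `D = i ∂_{x_2} + j ∂_{x_3} + k
∂_{x_4}` acts along the centre of the Heisenberg group. Both the units and the derivatives are skew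
for the real `L²` pairing, so `D` is symmetric, and `⟨F_{a+s}, F_{b-s}⟩` does not depend on `s`
(`integral_inner_slice_shift`). Hence `⟨F_s, F_t⟩ = ‖F_{(s+t)/2}‖²`. Expanding `‖F_s - F_t‖² ≥ 0`
shows that `t ↦ ‖F_t‖²` is midpoint convex; being bounded, it is nonincreasing, so it converges as
`t → 0+`, and the same expansion makes `F_t` Cauchy in `L²`. The limit `F^b` satisfies `‖F_t‖ ≤
‖F^b‖` for every `t > 0`.

Evaluations. A regular function is harmonic in each quaternionic variable, because the conjugate
operator times the Cauchy–Fueter operator is the Laplacian. As the functions are only `C¹`, this is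
used weakly, as a mean value property for radial mollifiers (`IsRegularOn.integral_mollifier_smul`).
Together with Fubini over the levels it bounds `|F(q)|` by `C ‖F^b‖`, locally uniformly in `q`
(`exists_local_bound`), and it carries regularity to locally bounded pointwise limits. So the
boundary values form a closed subspace of `L²` (`exists_hardy_of_tendsto`) on which evaluation at a
point is continuous.

Kernel. Riesz representation of the real part of evaluation, with right multiplication by
quaternions to recover the other components, gives reproducing functions `K_p`; then `S(q,p) =
K_p(q)`. Symmetry and uniqueness come from applying the reproducing formula to the kernels
themselves.

Nontriviality. Real derivatives of the Cauchy–Fueter kernel, taken at `q_1 + 1`, are regular and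
decay as fast as desired (`exists_memHardy_ne_zero`). -/

noncomputable section

namespace QuatSiegel

/-! ### Heisenberg coordinates, height above the boundary, and the measures -/

section

/-- The Heisenberg group `Im ℍ × ℍ^m` in real coordinates. -/
abbrev HeisCoord (m : ℕ) : Type := (Fin 3 → ℝ) × (Fin m → Fin 4 → ℝ)

instance isAddHaarMeasure_volume_heisCoord (m : ℕ) :
    (volume : Measure (HeisCoord m)).IsAddHaarMeasure := by
  have h4 : (volume : Measure (Fin 4 → ℝ)).IsAddHaarMeasure := inferInstance
  have h : (volume : Measure (Fin m → Fin 4 → ℝ)).IsAddHaarMeasure :=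
    Measure.pi.isAddHaarMeasure (μ := fun _ : Fin m => (volume : Measure (Fin 4 → ℝ)))
  exact Measure.prod.instIsAddHaarMeasure _ _

/-- The function `|q'|^2` in real coordinates. -/
def heisHeight {m : ℕ} (v : HeisCoord m) : ℝ := ∑ l : Fin m, ∑ a : Fin 4, v.2 l a ^ 2

theorem contDiff_heisHeight (m : ℕ) {k : WithTop ℕ∞} : ContDiff ℝ k (heisHeight (m := m)) := by
  unfold heisHeight
  fun_prop

theorem quat_norm_sq (a b c d : ℝ) : ‖quat a b c d‖ ^ 2 = a ^ 2 + b ^ 2 + c ^ 2 + d ^ 2 := by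
  rw [sq, ← Quaternion.normSq_eq_norm_mul_self, Quaternion.normSq_def']
  simp

/-- Real coordinates on `ℍ^(m+1)`, the real part of the first variable being separated. -/
def coordEquiv (m : ℕ) : (HeisCoord m × ℝ) ≃ₗ[ℝ] HVec m where
  toFun z := Fin.cons (quat z.2 (z.1.1 0) (z.1.1 1) (z.1.1 2)) (fun l => ofCoords (z.1.2 l))
  invFun q := ((![(q 0).imI, (q 0).imJ, (q 0).imK],
    fun l => ![(q l.succ).re, (q l.succ).imI, (q l.succ).imJ, (q l.succ).imK]), (q 0).re)
  map_add' x y := by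
    ext i <;> refine Fin.cases ?_ (fun l => ?_) i <;> simp [ofCoords]
  map_smul' c x := by
    ext i <;> refine Fin.cases ?_ (fun l => ?_) i <;> simp [ofCoords]
  left_inv z := by
    ext i
    · fin_cases i <;> rfl
    · rename_i a
      fin_cases a <;> rfl
    · rfl
  right_inv q := by
    ext i <;> refine Fin.cases ?_ (fun l => ?_) i <;> simp [ofCoords]

/-- `coordEquiv` as a continuous linear equivalence. -/
def coordCLE (m : ℕ) : (HeisCoord m × ℝ) ≃L[ℝ] HVec m := (coordEquiv m).toContinuousLinearEquiv

theorem coordCLE_apply {m : ℕ} (z : HeisCoord m × ℝ) :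
    coordCLE m z =
      Fin.cons (quat z.2 (z.1.1 0) (z.1.1 1) (z.1.1 2)) (fun l => ofCoords (z.1.2 l)) := rfl

/-- The point of height `t` above the boundary point with coordinates `v`. -/
def heightPoint {m : ℕ} (v : HeisCoord m) (t : ℝ) : HVec m :=
  boundaryParam m v + Pi.single 0 (t : ℍ)

theorem heightPoint_eq {m : ℕ} (v : HeisCoord m) (t : ℝ) :
    heightPoint v t = coordCLE m (v, heisHeight v + t) := by
  rw [coordCLE_apply]
  have h : ∀ l, ‖ofCoords (v.2 l)‖ ^ 2 = ∑ a : Fin 4, v.2 l a ^ 2 := fun l => by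
    rw [ofCoords, quat_norm_sq, Fin.sum_univ_four]
  funext i
  refine Fin.cases ?_ (fun l => ?_) i
  · simp only [heightPoint, boundaryParam, Pi.add_apply, Fin.cons_zero, Pi.single_eq_same, h,
      heisHeight]
    ext <;> simp
  · simp [heightPoint, boundaryParam]

/-- The height `Re q_1 - |q'|^2` above the boundary. -/
def height {m : ℕ} (q : HVec m) : ℝ := (q 0).re - tailNormSq q

theorem continuous_height (m : ℕ) : Continuous (height (m := m)) := by
  unfold height tailNormSq
  have : Continuous fun q : HVec m => (q 0).re :=
    Quaternion.continuous_re.comp (continuous_apply 0)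
  fun_prop

theorem mem_siegel_iff {m : ℕ} {q : HVec m} : q ∈ siegel m ↔ 0 < height q := by
  simp [siegel, height]

theorem isOpen_siegel (m : ℕ) : IsOpen (siegel m) := by
  have : siegel m = height ⁻¹' Set.Ioi 0 := by ext q; exact mem_siegel_iff
  rw [this]
  exact isOpen_Ioi.preimage (continuous_height m)

theorem height_heightPoint {m : ℕ} (v : HeisCoord m) (t : ℝ) : height (heightPoint v t) = t := by
  simp [height, heightPoint, boundaryParam, tailNormSq]

theorem heightPoint_mem {m : ℕ} (v : HeisCoord m) {t : ℝ} (ht : 0 < t) :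
    heightPoint v t ∈ siegel m := by
  rwa [mem_siegel_iff, height_heightPoint]

theorem isClosedEmbedding_boundaryParam (m : ℕ) :
    Topology.IsClosedEmbedding (boundaryParam m) := by
  refine Function.LeftInverse.isClosedEmbedding (f := fun q => ((coordCLE m).symm q).1) ?_
    (by fun_prop) (continuous_boundaryParam m)
  intro v
  have h := heightPoint_eq v 0
  have h0 : heightPoint v 0 = boundaryParam m v := by
    rw [heightPoint]
    funext i
    refine Fin.cases ?_ (fun l => ?_) i <;> simp
  rw [← h0, h]
  simp

theorem measurableEmbedding_boundaryParam (m : ℕ) : MeasurableEmbedding (boundaryParam m) :=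
  (isClosedEmbedding_boundaryParam m).measurableEmbedding

/-- The restriction of `F` to the level set of height `t`, in coordinates. -/
def slice {m : ℕ} (F : HVec m → ℍ) (t : ℝ) (v : HeisCoord m) : ℍ := F (heightPoint v t)

theorem aestronglyMeasurable_beta_iff {m : ℕ} {g : HVec m → ℍ} :
    AEStronglyMeasurable g (beta m) ↔ AEStronglyMeasurable (g ∘ boundaryParam m) volume :=
  (measurableEmbedding_boundaryParam m).aestronglyMeasurable_map_iff

theorem continuous_slice {m : ℕ} {F : HVec m → ℍ} (hF : ContinuousOn F (siegel m)) {t : ℝ}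
    (ht : 0 < t) : Continuous (slice F t) := by
  have h : Continuous fun v : HeisCoord m => heightPoint v t := by
    have h' := continuous_boundaryParam m
    unfold heightPoint
    fun_prop
  exact hF.comp_continuous h (fun v => heightPoint_mem v ht)

theorem aestronglyMeasurable_vertTranslate {m : ℕ} {F : HVec m → ℍ}
    (hF : ContinuousOn F (siegel m)) {t : ℝ} (ht : 0 < t) :
    AEStronglyMeasurable (vertTranslate F t) (beta m) :=
  aestronglyMeasurable_beta_iff.2 (continuous_slice hF ht).aestronglyMeasurable

theorem eLpNorm_two_sq {α E : Type*} [MeasurableSpace α] {μ : Measure α} [NormedAddCommGroup E]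
    (f : α → E) : eLpNorm f 2 μ ^ 2 = ∫⁻ x, ‖f x‖ₑ ^ 2 ∂μ := by
  have h := eLpNorm_nnreal_pow_eq_lintegral (f := f) (μ := μ) (p := 2) two_ne_zero
  simpa using h

/-- The Hardy condition as a uniform bound for the `L^2` norms of the translates. -/
theorem memHardy_iff {m : ℕ} {F : HVec m → ℍ} :
    MemHardy F ↔ IsRegularOn F (siegel m) ∧
      ∃ M : NNReal, ∀ t : ℝ, 0 < t → eLpNorm (vertTranslate F t) 2 (beta m) ≤ M := by
  refine and_congr_right fun _ => ?_
  simp only [← eLpNorm_two_sq]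
  constructor
  · intro h
    set S := ⨆ (ε : ℝ) (_ : 0 < ε), eLpNorm (fun q => vertTranslate F ε q) 2 (beta m) ^ 2 with hS
    refine ⟨((max S 1)).toNNReal, fun t ht => ?_⟩
    rw [ENNReal.coe_toNNReal (by simp [h.ne])]
    have h1 : eLpNorm (vertTranslate F t) 2 (beta m) ^ 2 ≤ S :=
      le_iSup₂ (f := fun (ε : ℝ) (_ : 0 < ε) =>
        eLpNorm (fun q => vertTranslate F ε q) 2 (beta m) ^ 2) t ht
    rcases le_total (eLpNorm (vertTranslate F t) 2 (beta m)) 1 with h2 | h2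
    · exact h2.trans (le_max_right _ _)
    · exact ((le_self_pow₀ h2 two_ne_zero).trans h1).trans (le_max_left _ _)
  · rintro ⟨M, hM⟩
    refine lt_of_le_of_lt (b := (M : ℝ≥0∞) ^ 2) (iSup₂_le fun t ht => ?_) (by finiteness)
    gcongr
    exact hM t ht

theorem eLpNorm_vertTranslate {m : ℕ} (F : HVec m → ℍ) (t : ℝ) :
    eLpNorm (vertTranslate F t) 2 (beta m) = eLpNorm (slice F t) 2 volume :=
  (measurableEmbedding_boundaryParam m).eLpNorm_map_measure

/-- Lebesgue measure on `ℍ^(m+1)`. -/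
def lebesgueH (m : ℕ) : Measure (HVec m) := Measure.map (coordCLE m) (volume.prod volume)

instance isAddHaarMeasure_lebesgueH (m : ℕ) : (lebesgueH m).IsAddHaarMeasure := by
  have : ((volume : Measure (HeisCoord m)).prod (volume : Measure ℝ)).IsAddHaarMeasure :=
    Measure.prod.instIsAddHaarMeasure _ _
  exact (coordCLE m).isAddHaarMeasure_map _

/-- For fixed `v` the height is merely translated by `|q'|²`, so the change of variables is a shear.
This permits Fubini over the level sets of the height. -/
theorem measurePreserving_heightPoint (m : ℕ) :
    MeasurePreserving (fun z : HeisCoord m × ℝ => heightPoint z.1 z.2)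
      (volume.prod volume) (lebesgueH m) := by
  have h1 : MeasurePreserving (fun z : HeisCoord m × ℝ => (z.1, heisHeight z.1 + z.2))
      (volume.prod volume) (volume.prod volume) := by
    refine (MeasurePreserving.id volume).skew_product
      (g := fun (v : HeisCoord m) (t : ℝ) => heisHeight v + t) ?_ ?_
    · have : Continuous (heisHeight (m := m)) := (contDiff_heisHeight m (k := 0)).continuous
      exact Continuous.measurable (by unfold Function.uncurry; fun_prop)
    · exact Eventually.of_forall fun v => map_add_left_eq_self volume _
  have h2 : MeasurePreserving (coordCLE m) (volume.prod volume) (lebesgueH m) :=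
    ⟨(coordCLE m).continuous.measurable, rfl⟩
  convert h2.comp h1 using 1
  funext z
  exact heightPoint_eq _ _

end

/-! ### The pairing of two slices against a cutoff -/

section

/-- Differentiation under the integral sign for integrands supported in a fixed compact set. -/
theorem hasDerivAt_integral_of_compact {V E : Type*} [TopologicalSpace V] [T2Space V]
    [SecondCountableTopology V] [MeasurableSpace V] [BorelSpace V] {μ : Measure V}
    [IsFiniteMeasureOnCompacts μ] [NormedAddCommGroup E] [NormedSpace ℝ E] {K : Set V}
    (hK : IsCompact K) {I : Set ℝ} (hI : IsOpen I) {s₀ : ℝ} (hs₀ : s₀ ∈ I) {g g' : ℝ → V → E}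
    (hg : ∀ s ∈ I, Continuous (g s)) (hgK : ∀ s ∈ I, ∀ v ∉ K, g s v = 0)
    (hg' : ContinuousOn (Function.uncurry g') (I ×ˢ Set.univ))
    (hg'K : ∀ s ∈ I, ∀ v ∉ K, g' s v = 0)
    (hd : ∀ s ∈ I, ∀ v, HasDerivAt (fun s => g s v) (g' s v) s) :
    HasDerivAt (fun s => ∫ v, g s v ∂μ) (∫ v, g' s₀ v ∂μ) s₀ := by
  obtain ⟨δ, hδ, hδI⟩ := Metric.nhds_basis_closedBall.mem_iff.1 (hI.mem_nhds hs₀)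
  have hcomp : IsCompact (Metric.closedBall s₀ δ ×ˢ K) := (isCompact_closedBall s₀ δ).prod hK
  obtain ⟨C, hC⟩ := hcomp.exists_bound_of_continuousOn
    (hg'.mono (Set.prod_mono hδI (Set.subset_univ K)))
  have hcs : ∀ s ∈ I, HasCompactSupport (g s) := fun s hs =>
    HasCompactSupport.intro hK fun v hv => hgK s hs v hv
  have hc' : Continuous (g' s₀) := by
    rw [← continuousOn_univ]
    exact hg'.comp (f := fun v => (s₀, v)) (by fun_prop) (fun v _ => ⟨hs₀, trivial⟩)
  refine (hasDerivAt_integral_of_dominated_loc_of_deriv_le (μ := μ) (F := g) (F' := g')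
    (bound := K.indicator fun _ => C) (s := Metric.closedBall s₀ δ)
    (Metric.closedBall_mem_nhds s₀ hδ) ?_ ?_ ?_ ?_ ?_ ?_).2
  · filter_upwards [hI.mem_nhds hs₀] with s hs
    exact ((hg s hs).integrable_of_hasCompactSupport (hcs s hs)).aestronglyMeasurable
  · exact (hg s₀ hs₀).integrable_of_hasCompactSupport (hcs s₀ hs₀)
  · exact (hc'.integrable_of_hasCompactSupport
      (HasCompactSupport.intro hK fun v hv => hg'K s₀ hs₀ v hv)).aestronglyMeasurable
  · refine Eventually.of_forall fun v s hs => ?_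
    by_cases hv : v ∈ K
    · rw [Set.indicator_of_mem hv]
      exact hC (s, v) ⟨hs, hv⟩
    · rw [Set.indicator_of_notMem hv, hg'K s (hδI hs) v hv, norm_zero]
  · exact (integrable_indicator_iff hK.measurableSet).2 (integrableOn_const hK.measure_lt_top.ne)
  · exact Eventually.of_forall fun v s hs => hd s (hδI hs) v

/-- The imaginary units `i, j, k`. -/
def imUnit : Fin 3 → ℍ := ![quat 0 1 0 0, quat 0 0 1 0, quat 0 0 0 1]

theorem imUnit_zero : imUnit 0 = quat 0 1 0 0 := rfl
theorem imUnit_one : imUnit 1 = quat 0 0 1 0 := rfl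
theorem imUnit_two : imUnit 2 = quat 0 0 0 1 := rfl

theorem norm_imUnit (c : Fin 3) : ‖imUnit c‖ = 1 := by
  have h : ‖imUnit c‖ ^ 2 = 1 := by fin_cases c <;> simp [imUnit, quat_norm_sq]
  nlinarith [norm_nonneg (imUnit c)]

/-- This skewness, combined with that of `∂_c` under integration by parts, makes `∑ i_c ∂_c`
symmetric. -/
theorem inner_imUnit_mul_left (c : Fin 3) (a b : ℍ) :
    inner ℝ (imUnit c * a) b = -inner ℝ a (imUnit c * b) := by
  fin_cases c <;> simp [imUnit, Quaternion.inner_def] <;> ring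

theorem cauchyFueter_eq_sum {m : ℕ} (l : Fin (m + 1)) (f : HVec m → ℍ) (q : HVec m) :
    cauchyFueter l f q = fderiv ℝ f q (Pi.single l 1)
      + ∑ c, imUnit c * fderiv ℝ f q (Pi.single l (imUnit c)) := by
  rw [Fin.sum_univ_three, cauchyFueter, imUnit_zero, imUnit_one, imUnit_two]
  abel

/-- The coordinate directions of `Im ℍ` in the Heisenberg group. -/
def vertDir (m : ℕ) (c : Fin 3) : HeisCoord m := (Pi.single c 1, 0)

/-- `|q'|²` does not involve `Im q_1`, so motion in a central direction stays on the level set and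
is a straight line in `ℍ^(m+1)`. Line derivatives of slices are therefore plain partial derivatives
of `F`. -/
theorem heightPoint_add_vertDir {m : ℕ} (v : HeisCoord m) (t h : ℝ) (c : Fin 3) :
    heightPoint (v + h • vertDir m c) t = heightPoint v t + h • (Pi.single 0 (imUnit c) : HVec m) := by
  funext i
  refine Fin.cases ?_ (fun l => ?_) i
  · ext <;> fin_cases c <;> simp [heightPoint, boundaryParam, vertDir, imUnit, ofCoords]
  · simp [heightPoint, boundaryParam, vertDir]

theorem heightPoint_add_real {m : ℕ} (v : HeisCoord m) (t h : ℝ) :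
    heightPoint v (t + h) = heightPoint v t + h • (Pi.single 0 1 : HVec m) := by
  simp only [heightPoint, add_assoc, ← Pi.single_smul, ← Pi.single_add]
  congr 2
  ext <;> simp

variable {m : ℕ} {F : HVec m → ℍ}

theorem IsRegularOn.differentiableAt {U : Set (HVec m)} (hU : IsOpen U) (hF : IsRegularOn F U)
    {q : HVec m} (hq : q ∈ U) : DifferentiableAt ℝ F q :=
  (hF.1.contDiffAt (hU.mem_nhds hq)).differentiableAt one_ne_zero

theorem hasDerivAt_slice (hF : IsRegularOn F (siegel m)) (v : HeisCoord m) {t : ℝ} (ht : 0 < t) :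
    HasDerivAt (fun t => slice F t v) (fderiv ℝ F (heightPoint v t) (Pi.single 0 1)) t := by
  have h := (hF.differentiableAt (isOpen_siegel m)
    (heightPoint_mem v ht)).hasFDerivAt.hasLineDerivAt (Pi.single 0 1)
  have h2 : HasDerivAt (fun s => F (heightPoint v t + s • (Pi.single 0 1 : HVec m)))
    (fderiv ℝ F (heightPoint v t) (Pi.single 0 1)) (t - t) := by
    rw [sub_self]; exact h
  have h3 := h2.comp_sub_const t t
  refine h3.congr_of_eventuallyEq (Eventually.of_forall fun s => ?_)
  simp only [slice, ← heightPoint_add_real, add_sub_cancel]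

theorem hasLineDerivAt_slice (hF : IsRegularOn F (siegel m)) (v : HeisCoord m) {t : ℝ}
    (ht : 0 < t) (c : Fin 3) :
    HasLineDerivAt ℝ (slice F t) (fderiv ℝ F (heightPoint v t) (Pi.single 0 (imUnit c))) v
      (vertDir m c) := by
  have h := (hF.differentiableAt (isOpen_siegel m)
    (heightPoint_mem v ht)).hasFDerivAt.hasLineDerivAt (Pi.single 0 (imUnit c))
  unfold HasLineDerivAt slice at *
  simpa only [heightPoint_add_vertDir] using h

theorem continuousOn_fderiv_slice (hF : IsRegularOn F (siegel m)) (e : HVec m) {X : Type*}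
    [TopologicalSpace X] {S : Set X} {τ : X → ℝ} {w : X → HeisCoord m} (hτ : Continuous τ)
    (hw : Continuous w) (hS : ∀ x ∈ S, 0 < τ x) :
    ContinuousOn (fun x => fderiv ℝ F (heightPoint (w x) (τ x)) e) S := by
  have h1 := hF.1.continuousOn_fderiv_of_isOpen (isOpen_siegel m) le_rfl
  have h2 : Continuous fun x => heightPoint (w x) (τ x) := by
    exact ((continuous_boundaryParam m).comp hw).add
      ((continuous_single 0).comp (Quaternion.continuous_coe.comp hτ))
  have h3 := h1.comp h2.continuousOn fun x hx => heightPoint_mem (w x) (hS x hx)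
  exact h3.clm_apply continuousOn_const

theorem continuousOn_slice (hF : IsRegularOn F (siegel m)) {X : Type*}
    [TopologicalSpace X] {S : Set X} {τ : X → ℝ} {w : X → HeisCoord m} (hτ : Continuous τ)
    (hw : Continuous w) (hS : ∀ x ∈ S, 0 < τ x) :
    ContinuousOn (fun x => slice F (τ x) (w x)) S := by
  have h2 : Continuous fun x => heightPoint (w x) (τ x) := by
    exact ((continuous_boundaryParam m).comp hw).add
      ((continuous_single 0).comp (Quaternion.continuous_coe.comp hτ))
  exact hF.1.continuousOn.comp h2.continuousOn fun x hx => heightPoint_mem (w x) (hS x hx)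

/-- With `s` and `t` replaced by `a + s` and `b - s`, the left side is the `s`-derivative of the
integrand of the pairing. Substituting the Cauchy–Fueter equation in the variable `q_1` turns it
into a divergence in the central directions. -/
theorem inner_deriv_slice_eq (hF : IsRegularOn F (siegel m)) (v : HeisCoord m) {s t : ℝ}
    (hs : 0 < s) (ht : 0 < t) :
    inner ℝ (slice F s v) (-fderiv ℝ F (heightPoint v t) (Pi.single 0 1))
      + inner ℝ (fderiv ℝ F (heightPoint v s) (Pi.single 0 1)) (slice F t v)
    = ∑ c, (inner ℝ (slice F s v)
        (imUnit c * fderiv ℝ F (heightPoint v t) (Pi.single 0 (imUnit c)))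
      + inner ℝ (fderiv ℝ F (heightPoint v s) (Pi.single 0 (imUnit c)))
        (imUnit c * slice F t v)) := by
  have e : ∀ r, 0 < r → fderiv ℝ F (heightPoint v r) (Pi.single 0 1) =
      -∑ c, imUnit c * fderiv ℝ F (heightPoint v r) (Pi.single 0 (imUnit c)) := fun r hr => by
    have h := hF.2 0 _ (heightPoint_mem v hr)
    rw [cauchyFueter_eq_sum] at h
    exact eq_neg_of_add_eq_zero_left h
  rw [e t ht, e s hs, neg_neg, inner_neg_left, inner_sum, sum_inner, Finset.sum_add_distrib,
    ← Finset.sum_neg_distrib]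
  simp only [inner_imUnit_mul_left, neg_neg]

theorem hasLineDerivAt_inner_slice (hF : IsRegularOn F (siegel m)) (v : HeisCoord m) {s t : ℝ}
    (hs : 0 < s) (ht : 0 < t) (c : Fin 3) :
    HasLineDerivAt ℝ (fun v => inner ℝ (slice F s v) (imUnit c * slice F t v))
      (inner ℝ (slice F s v)
        (imUnit c * fderiv ℝ F (heightPoint v t) (Pi.single 0 (imUnit c)))
      + inner ℝ (fderiv ℝ F (heightPoint v s) (Pi.single 0 (imUnit c)))
        (imUnit c * slice F t v)) v (vertDir m c) := by
  have h1 := hasLineDerivAt_slice hF v hs c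
  have h2 := hasLineDerivAt_slice hF v ht c
  unfold HasLineDerivAt at *
  have h3 := h1.inner ℝ (h2.const_mul (imUnit c))
  simpa using h3

/-- The derivative of the integrand is `χ` times a divergence; integration by parts leaves only
terms in which the cutoff is differentiated, and these vanish as the cutoff spreads out. -/
theorem hasDerivAt_integral_cutoff (hF : IsRegularOn F (siegel m)) {χ : HeisCoord m → ℝ}
    (hχ : ContDiff ℝ 1 χ) (hχc : HasCompactSupport χ) {a b s : ℝ} (has : 0 < a + s)
    (hbs : 0 < b - s) :
    HasDerivAt (fun s => ∫ v, χ v * inner ℝ (slice F (a + s) v) (slice F (b - s) v))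
      (-∫ v, ∑ c, fderiv ℝ χ v (vertDir m c) *
        inner ℝ (slice F (a + s) v) (imUnit c * slice F (b - s) v)) s := by
  have hcχ : Continuous χ := hχ.continuous
  have hI : IsOpen (Set.Ioo (-a) b) := isOpen_Ioo
  have h := hasDerivAt_integral_of_compact (μ := (volume : Measure (HeisCoord m))) (K := tsupport χ)
    (s₀ := s) hχc hI ⟨by linarith, by linarith⟩
    (g := fun s v => χ v * inner ℝ (slice F (a + s) v) (slice F (b - s) v))
    (g' := fun s v => χ v *
      (inner ℝ (slice F (a + s) v) (-fderiv ℝ F (heightPoint v (b - s)) (Pi.single 0 1))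
      + inner ℝ (fderiv ℝ F (heightPoint v (a + s)) (Pi.single 0 1)) (slice F (b - s) v)))
    ?_ ?_ ?_ ?_ ?_
  · refine HasDerivAt.congr_deriv h (Eq.symm ?_)
    have hb : ∀ v, v ∉ tsupport χ → χ v = 0 := fun v hv => image_eq_zero_of_notMem_tsupport hv
    have hca := continuous_slice hF.1.continuousOn has
    have hcb := continuous_slice hF.1.continuousOn hbs
    have hcd : ∀ r, 0 < r → ∀ c, Continuous fun v : HeisCoord m =>
        fderiv ℝ F (heightPoint v r) (Pi.single 0 (imUnit c)) := fun r hr c => by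
      rw [← continuousOn_univ]
      exact continuousOn_fderiv_slice hF _ (τ := fun _ => r) (w := fun v => v) continuous_const
        continuous_id fun _ _ => hr
    have hcχ' : ∀ c, Continuous fun v => fderiv ℝ χ v (vertDir m c) := fun c =>
      (hχ.continuous_fderiv one_ne_zero).clm_apply continuous_const
    have hcχ's : ∀ c, HasCompactSupport fun v => fderiv ℝ χ v (vertDir m c) := fun c =>
      hχc.fderiv_apply ℝ _
    have hd := fun c => hcd (a + s) has c
    have hd' := fun c => hcd (b - s) hbs c
    simp only [inner_deriv_slice_eq hF _ has hbs, Finset.mul_sum]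
    rw [integral_finsetSum, integral_finsetSum, ← Finset.sum_neg_distrib]
    · refine Finset.sum_congr rfl fun c _ => ?_
      refine (integral_bilinear_hasLineDerivAt_right_eq_neg_left_of_integrable
        (B := ContinuousLinearMap.mul ℝ ℝ) (v := vertDir m c) (f := χ)
        (f' := fun v => fderiv ℝ χ v (vertDir m c))
        (g := fun v => inner ℝ (slice F (a + s) v) (imUnit c * slice F (b - s) v))
        ?_ ?_ ?_ ?_ ?_).symm
      · exact Continuous.integrable_of_hasCompactSupport
          ((hcχ' c).mul (hca.inner (continuous_const.mul hcb))) (hcχ's c).mul_right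
      · exact Continuous.integrable_of_hasCompactSupport
          (hcχ.mul ((hca.inner (continuous_const.mul (hd' c))).add
            ((hd c).inner (continuous_const.mul hcb)))) hχc.mul_right
      · exact Continuous.integrable_of_hasCompactSupport
          (hcχ.mul (hca.inner (continuous_const.mul hcb))) hχc.mul_right
      · exact fun v _ => ((hχ.differentiable one_ne_zero) v).hasFDerivAt.hasLineDerivAt _
      · exact fun v _ => hasLineDerivAt_inner_slice hF v has hbs c
    · exact fun c _ => Continuous.integrable_of_hasCompactSupport
          (hcχ.mul ((hca.inner (continuous_const.mul (hd' c))).add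
            ((hd c).inner (continuous_const.mul hcb)))) hχc.mul_right
    · exact fun c _ => Continuous.integrable_of_hasCompactSupport
          ((hcχ' c).mul (hca.inner (continuous_const.mul hcb))) (hcχ's c).mul_right
  · intro s hs
    exact hcχ.mul ((continuous_slice hF.1.continuousOn (by linarith [hs.1])).inner
      (continuous_slice hF.1.continuousOn (by linarith [hs.2])))
  · intro s _ v hv
    simp [image_eq_zero_of_notMem_tsupport hv]
  · have hp1 : ∀ x ∈ Set.Ioo (-a) b ×ˢ (Set.univ : Set (HeisCoord m)), 0 < a + x.1 :=
      fun x hx => by linarith [hx.1.1]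
    have hp2 : ∀ x ∈ Set.Ioo (-a) b ×ˢ (Set.univ : Set (HeisCoord m)), 0 < b - x.1 :=
      fun x hx => by linarith [hx.1.2]
    have e1 := continuousOn_slice hF (τ := fun x : ℝ × HeisCoord m => a + x.1)
      (w := Prod.snd) (by fun_prop) (by fun_prop) hp1
    have e2 := continuousOn_slice hF (τ := fun x : ℝ × HeisCoord m => b - x.1)
      (w := Prod.snd) (by fun_prop) (by fun_prop) hp2
    have e3 := continuousOn_fderiv_slice hF (Pi.single 0 1)
      (τ := fun x : ℝ × HeisCoord m => a + x.1) (w := Prod.snd) (by fun_prop) (by fun_prop) hp1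
    have e4 := continuousOn_fderiv_slice hF (Pi.single 0 1)
      (τ := fun x : ℝ × HeisCoord m => b - x.1) (w := Prod.snd) (by fun_prop) (by fun_prop) hp2
    exact (hcχ.comp continuous_snd).continuousOn.mul ((e1.inner e4.neg).add (e3.inner e2))
  · intro s _ v hv
    simp [image_eq_zero_of_notMem_tsupport hv]
  · intro s hs v
    have h1 := (hasDerivAt_slice hF v (t := a + s) (by linarith [hs.1])).comp_const_add a s
    have h2 := HasDerivAt.scomp s (g₁ := fun t => slice F t v) (h := fun s => b - s)
      (hasDerivAt_slice hF v (t := b - s) (by linarith [hs.2])) ((hasDerivAt_id s).const_sub b)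
    simp only [neg_smul, one_smul] at h2
    exact (h1.inner ℝ h2).const_mul (χ v)

end

/-! ### Removing the cutoff: the shift identity -/

section

variable {m : ℕ} {F : HVec m → ℍ}

/-- Smooth compactly supported functions with values in `[0, 1]`, small derivatives, converging
to `1`. -/
theorem exists_cutoff_seq (m : ℕ) : ∃ (C : ℝ) (χ : ℕ → HeisCoord m → ℝ),
    (∀ n, ContDiff ℝ 1 (χ n)) ∧ (∀ n, HasCompactSupport (χ n)) ∧ (∀ n v, 0 ≤ χ n v) ∧
    (∀ n v, χ n v ≤ 1) ∧ (∀ v, Tendsto (fun n => χ n v) atTop (𝓝 1)) ∧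
    ∀ n v c, |fderiv ℝ (χ n) v (vertDir m c)| ≤ C / (n + 1) := by
  let b : ContDiffBump (0 : HeisCoord m) := ⟨1, 2, one_pos, one_lt_two⟩
  have hb : ContDiff ℝ 1 b := b.contDiff
  have hK : ∀ c, ∃ C, ∀ v, |fderiv ℝ b v (vertDir m c)| ≤ C := fun c => by
    have h1 : Continuous fun v => fderiv ℝ b v (vertDir m c) :=
      (hb.continuous_fderiv one_ne_zero).clm_apply continuous_const
    have h2 : HasCompactSupport fun v => fderiv ℝ b v (vertDir m c) :=
      b.hasCompactSupport.fderiv_apply ℝ _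
    exact h1.bounded_above_of_compact_support h2
  choose C hC using hK
  refine ⟨∑ c, |C c|, fun n v => b (((n : ℝ) + 1)⁻¹ • v), fun n => by fun_prop, fun n => ?_,
    fun n v => b.nonneg, fun n v => b.le_one, fun v => ?_, fun n v c => ?_⟩
  · exact b.hasCompactSupport.comp_smul (by positivity)
  · refine tendsto_const_nhds.congr' ?_
    obtain ⟨N, hN⟩ := exists_nat_gt ‖v‖
    filter_upwards [eventually_ge_atTop N] with n hn
    have hn' : (N : ℝ) ≤ n := by exact_mod_cast hn
    refine (b.one_of_mem_closedBall ?_).symm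
    rw [mem_closedBall_zero_iff, norm_smul, norm_inv, Real.norm_of_nonneg (by positivity)]
    change _ ≤ (1 : ℝ)
    rw [inv_mul_le_iff₀ (by positivity)]
    linarith
  · change |fderiv ℝ (fun v => (b : HeisCoord m → ℝ) (((n : ℝ) + 1)⁻¹ • v)) v (vertDir m c)| ≤ _
    rw [fderiv_comp_smul, _root_.smul_apply, smul_eq_mul, abs_mul,
      abs_of_nonneg (by positivity), ← div_eq_inv_mul]
    gcongr
    exact (hC c _).trans ((le_abs_self _).trans
      (Finset.single_le_sum (f := fun c => |C c|) (fun _ _ => abs_nonneg _) (Finset.mem_univ c)))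

theorem integrable_inner_of_memLp {α E : Type*} [MeasurableSpace α] {μ : Measure α}
    [NormedAddCommGroup E] [InnerProductSpace ℝ E] {f g : α → E} (hf : MemLp f 2 μ)
    (hg : MemLp g 2 μ) : Integrable (fun x => inner ℝ (f x) (g x)) μ := by
  refine (L2.integrable_inner (𝕜 := ℝ) (hf.toLp f) (hg.toLp g)).congr ?_
  filter_upwards [hf.coeFn_toLp, hg.coeFn_toLp] with x h1 h2
  rw [h1, h2]

/-- The `L^2` pairing of two translates depends only on the sum of their heights. -/
theorem integral_inner_slice_shift (hF : IsRegularOn F (siegel m))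
    (h2 : ∀ t, 0 < t → MemLp (slice F t) 2 volume) {B : ℝ}
    (hB : ∀ t, 0 < t → ∫ v, ‖slice F t v‖ ^ 2 ≤ B) {a b s : ℝ} (ha : 0 < a) (hs : 0 ≤ s)
    (hsb : s < b) :
    ∫ v, inner ℝ (slice F (a + s) v) (slice F (b - s) v) =
      ∫ v, inner ℝ (slice F a v) (slice F b v) := by
  obtain ⟨C, χ, hχ, hχc, hχ0, hχ1, hχlim, hχd⟩ := exists_cutoff_seq m
  have hint : ∀ t, 0 < t → ∀ r, 0 < r →
      Integrable (fun v => inner ℝ (slice F t v) (slice F r v)) volume := fun t ht r hr =>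
    integrable_inner_of_memLp (h2 t ht) (h2 r hr)
  have hsq : ∀ t, 0 < t → Integrable (fun v => ‖slice F t v‖ ^ 2) volume := fun t ht =>
    (h2 t ht).integrable_norm_pow two_ne_zero
  have hlim : ∀ t, 0 < t → ∀ r, 0 < r →
      Tendsto (fun n => ∫ v, χ n v * inner ℝ (slice F t v) (slice F r v)) atTop
        (𝓝 (∫ v, inner ℝ (slice F t v) (slice F r v))) := fun t ht r hr => by
    refine tendsto_integral_of_dominated_convergence
      (fun v => ‖(inner ℝ (slice F t v) (slice F r v) : ℝ)‖)
      (fun n => ((hχ n).continuous.aestronglyMeasurable).mul (hint t ht r hr).aestronglyMeasurable)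
      (hint t ht r hr).norm (fun n => Eventually.of_forall fun v => ?_)
      (Eventually.of_forall fun v => ?_)
    · rw [norm_mul, Real.norm_of_nonneg (hχ0 n v)]
      exact mul_le_of_le_one_left (norm_nonneg _) (hχ1 n v)
    · simpa using (hχlim v).mul_const (inner ℝ (slice F t v) (slice F r v))
  have hbound : ∀ n : ℕ, ‖(∫ v, χ n v * inner ℝ (slice F (a + s) v) (slice F (b - s) v)) -
      ∫ v, χ n v * inner ℝ (slice F (a + 0) v) (slice F (b - 0) v)‖ ≤
        3 * (C / (n + 1)) * B * ‖s - 0‖ := fun n => by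
    -- Mean value inequality in `s`. The factor `3` counts the central directions, `C / (n + 1)`
    -- bounds the derivatives of the cutoff, and `|⟨x, i_c y⟩| ≤ (|x|² + |y|²) / 2` integrates to at
    -- most `B`.
    refine (convex_Icc (0 : ℝ) s).norm_image_sub_le_of_norm_hasDerivWithin_le
      (fun σ hσ => (hasDerivAt_integral_cutoff hF (hχ n) (hχc n) (a := a) (b := b) (s := σ)
        (by linarith [hσ.1]) (by linarith [hσ.2])).hasDerivWithinAt)
      (fun σ hσ => ?_) (Set.left_mem_Icc.2 hs) (Set.right_mem_Icc.2 hs)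
    have p1 : 0 < a + σ := by linarith [hσ.1]
    have p2 : 0 < b - σ := by linarith [hσ.2]
    have hCn : 0 ≤ C / (n + 1) := (abs_nonneg _).trans (hχd n 0 0)
    rw [norm_neg]
    refine (norm_integral_le_of_norm_le (g := fun v => 3 * (C / (n + 1)) *
      ((‖slice F (a + σ) v‖ ^ 2 + ‖slice F (b - σ) v‖ ^ 2) / 2))
      ((((hsq _ p1).add (hsq _ p2)).div_const 2).const_mul _)
      (Eventually.of_forall fun v => ?_)).trans ?_
    · have e : ∀ c : Fin 3, ‖fderiv ℝ (χ n) v (vertDir m c) *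
          inner ℝ (slice F (a + σ) v) (imUnit c * slice F (b - σ) v)‖ ≤
          C / (n + 1) * ((‖slice F (a + σ) v‖ ^ 2 + ‖slice F (b - σ) v‖ ^ 2) / 2) := fun c => by
        rw [norm_mul]
        have e1 := norm_inner_le_norm (𝕜 := ℝ) (slice F (a + σ) v) (imUnit c * slice F (b - σ) v)
        rw [norm_mul, norm_imUnit, one_mul] at e1
        refine mul_le_mul (hχd n v c) (e1.trans ?_) (norm_nonneg _) hCn
        nlinarith [sq_nonneg (‖slice F (a + σ) v‖ - ‖slice F (b - σ) v‖)]
      refine (norm_sum_le_of_le _ fun c _ => e c).trans (le_of_eq ?_)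
      rw [Finset.sum_const, Finset.card_univ, Fintype.card_fin, nsmul_eq_mul]
      push_cast
      ring
    · rw [integral_const_mul, integral_div, integral_add (hsq _ p1) (hsq _ p2)]
      refine mul_le_mul_of_nonneg_left ?_ (by positivity)
      linarith [hB _ p1, hB _ p2]
  have l1 := ((hlim (a + s) (by linarith) (b - s) (by linarith)).sub
    (hlim (a + 0) (by linarith) (b - 0) (by linarith))).norm
  have l2 : Tendsto (fun n : ℕ => 3 * (C / ((n : ℝ) + 1)) * B * ‖s - 0‖) atTop (𝓝 0) := by
    have h3 : Tendsto (fun n : ℕ => C * (1 / ((n : ℝ) + 1))) atTop (𝓝 (C * 0)) :=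
      tendsto_one_div_add_atTop_nhds_zero_nat.const_mul C
    have h4 := ((h3.const_mul 3).mul_const B).mul_const ‖s - 0‖
    simpa [div_eq_mul_inv] using h4
  have h5 := le_of_tendsto_of_tendsto' l1 l2 hbound
  have h6 := norm_le_zero_iff.1 h5
  rw [add_zero, sub_zero] at h6
  exact sub_eq_zero.1 h6

/-! ### Hilbert space curves satisfying the shift identity -/

section Hilbert

variable {E : Type*} [NormedAddCommGroup E] [InnerProductSpace ℝ E]

theorem inner_eq_of_shift {u : ℝ → E}
    (h : ∀ a b s, 0 < a → 0 ≤ s → s < b → inner ℝ (u (a + s)) (u (b - s)) = inner ℝ (u a) (u b))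
    {s t : ℝ} (hs : 0 < s) (ht : 0 < t) :
    inner ℝ (u s) (u t) = ‖u ((s + t) / 2)‖ ^ 2 := by
  wlog hst : s ≤ t generalizing s t
  · rw [real_inner_comm, this ht hs (le_of_not_ge hst), add_comm]
  · have h1 := h s t ((t - s) / 2) hs (by linarith) (by linarith)
    rw [← h1, ← real_inner_self_eq_norm_sq]
    congr 2 <;> ring

theorem norm_sub_sq_of_shift {u : ℝ → E}
    (h : ∀ a b s, 0 < a → 0 ≤ s → s < b → inner ℝ (u (a + s)) (u (b - s)) = inner ℝ (u a) (u b))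
    {s t : ℝ} (hs : 0 < s) (ht : 0 < t) :
    ‖u s - u t‖ ^ 2 = ‖u s‖ ^ 2 + ‖u t‖ ^ 2 - 2 * ‖u ((s + t) / 2)‖ ^ 2 := by
  rw [norm_sub_sq_real, inner_eq_of_shift h hs ht]
  ring

/-- By `norm_sub_sq_of_shift` the function `‖u‖²` is midpoint convex. Its increments along an
arithmetic progression do not decrease, so one positive increment would force linear growth, against
the bound `M`. -/
theorem norm_sq_antitone_of_shift {u : ℝ → E}
    (h : ∀ a b s, 0 < a → 0 ≤ s → s < b → inner ℝ (u (a + s)) (u (b - s)) = inner ℝ (u a) (u b))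
    {M : ℝ} (hM : ∀ t, 0 < t → ‖u t‖ ≤ M) {x y : ℝ} (hx : 0 < x) (hxy : x ≤ y) :
    ‖u y‖ ^ 2 ≤ ‖u x‖ ^ 2 := by
  by_contra! hlt
  have hd : 0 ≤ y - x := by linarith
  have hpos : ∀ n : ℕ, 0 < x + n * (y - x) := fun n => by positivity
  have hstep : ∀ n : ℕ, ‖u y‖ ^ 2 - ‖u x‖ ^ 2 ≤
      ‖u (x + (n + 1 : ℕ) * (y - x))‖ ^ 2 - ‖u (x + n * (y - x))‖ ^ 2 := by
    intro n
    induction n with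
    | zero => simp
    | succ n ih =>
      have h1 := norm_sub_sq_of_shift h (hpos n) (hpos (n + 2))
      rw [show (x + n * (y - x) + (x + (n + 2 : ℕ) * (y - x))) / 2 = x + (n + 1 : ℕ) * (y - x) by
        push_cast; ring] at h1
      have h2 := sq_nonneg ‖u (x + n * (y - x)) - u (x + (n + 2 : ℕ) * (y - x))‖
      have h3 : ((n + 1 + 1 : ℕ) : ℝ) = (n + 2 : ℕ) := rfl
      rw [h3]
      linarith
  have hsum : ∀ n : ℕ, n * (‖u y‖ ^ 2 - ‖u x‖ ^ 2) ≤ ‖u (x + n * (y - x))‖ ^ 2 := by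
    intro n
    induction n with
    | zero => simp
    | succ n ih =>
      have := hstep n
      push_cast at this ⊢
      linarith
  obtain ⟨n, hn⟩ := exists_nat_gt (M ^ 2 / (‖u y‖ ^ 2 - ‖u x‖ ^ 2))
  rw [div_lt_iff₀ (by linarith)] at hn
  have h4 := hM _ (hpos n)
  have h5 : ‖u (x + n * (y - x))‖ ^ 2 ≤ M ^ 2 := by gcongr
  linarith [hsum n]

/-- Choose `x` with `‖u x‖²` within `ε²/4` of the supremum. For `s, t < x` the midpoint also lies
below `x`, so monotonicity and the identity for `‖u s - u t‖²` give at most `ε²/2`. -/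
theorem exists_limit_of_shift [CompleteSpace E] {u : ℝ → E}
    (h : ∀ a b s, 0 < a → 0 ≤ s → s < b → inner ℝ (u (a + s)) (u (b - s)) = inner ℝ (u a) (u b))
    {M : ℝ} (hM : ∀ t, 0 < t → ‖u t‖ ≤ M) :
    ∃ g, Tendsto u (𝓝[>] 0) (𝓝 g) := by
  set S := (fun t => ‖u t‖ ^ 2) '' Set.Ioi 0 with hS
  have hbdd : BddAbove S := ⟨M ^ 2, by
    rintro _ ⟨t, ht, rfl⟩
    have := hM t ht
    dsimp only
    gcongr⟩
  have hne : S.Nonempty := ⟨_, 1, Set.mem_Ioi.2 one_pos, rfl⟩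
  refine cauchy_map_iff_exists_tendsto.1 ?_
  rw [Metric.cauchy_iff]
  refine ⟨inferInstance, fun ε hε => ?_⟩
  obtain ⟨_, ⟨x, hx, rfl⟩, hlt⟩ := exists_lt_of_lt_csSup hne
    (show sSup S - ε ^ 2 / 4 < sSup S by linarith [pow_pos hε 2])
  have hx' : (0 : ℝ) < x := hx
  refine ⟨u '' Set.Ioo 0 x, image_mem_map (Ioo_mem_nhdsGT hx'), ?_⟩
  rintro _ ⟨s, hs, rfl⟩ _ ⟨t, ht, rfl⟩
  rw [dist_eq_norm]
  have h1 := norm_sub_sq_of_shift h hs.1 ht.1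
  have h2 : ‖u s‖ ^ 2 ≤ sSup S := le_csSup hbdd ⟨s, hs.1, rfl⟩
  have h3 : ‖u t‖ ^ 2 ≤ sSup S := le_csSup hbdd ⟨t, ht.1, rfl⟩
  have h4 := norm_sq_antitone_of_shift h hM (x := (s + t) / 2) (y := x)
    (by linarith [hs.1, ht.1]) (by linarith [hs.2, ht.2])
  dsimp only at hlt
  have h5 : ‖u s - u t‖ ^ 2 < ε ^ 2 := by linarith [pow_pos hε 2]
  exact lt_of_pow_lt_pow_left₀ 2 hε.le h5

theorem norm_le_limit_of_shift {u : ℝ → E}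
    (h : ∀ a b s, 0 < a → 0 ≤ s → s < b → inner ℝ (u (a + s)) (u (b - s)) = inner ℝ (u a) (u b))
    {M : ℝ} (hM : ∀ t, 0 < t → ‖u t‖ ≤ M) {g : E} (hg : Tendsto u (𝓝[>] 0) (𝓝 g)) {t : ℝ}
    (ht : 0 < t) : ‖u t‖ ≤ ‖g‖ := by
  refine ge_of_tendsto hg.norm ?_
  filter_upwards [Ioo_mem_nhdsGT ht] with s hs
  exact pow_le_pow_iff_left₀ (norm_nonneg _) (norm_nonneg _) two_ne_zero |>.1
    (norm_sq_antitone_of_shift h hM hs.1 hs.2.le)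

end Hilbert

/-! ### Existence and uniqueness of boundary values -/

theorem MemHardy.memLp (hF : MemHardy F) {t : ℝ} (ht : 0 < t) :
    MemLp (vertTranslate F t) 2 (beta m) := by
  obtain ⟨hr, M, hM⟩ := memHardy_iff.1 hF
  exact ⟨aestronglyMeasurable_vertTranslate hr.1.continuousOn ht,
    (hM t ht).trans_lt ENNReal.coe_lt_top⟩

/-- The translates of a Hardy function as elements of `L^2`. -/
def hardySlice (hF : MemHardy F) (t : ℝ) : Lp ℍ 2 (beta m) :=
  -- The value for `t ≤ 0` is arbitrary: only the limit along `𝓝[>] 0` is taken.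
  open Classical in if ht : 0 < t then (hF.memLp ht).toLp _ else 0

theorem hardySlice_of_pos (hF : MemHardy F) {t : ℝ} (ht : 0 < t) :
    hardySlice hF t = (hF.memLp ht).toLp _ := dif_pos ht

theorem inner_hardySlice (hF : MemHardy F) {s t : ℝ} (hs : 0 < s) (ht : 0 < t) :
    inner ℝ (hardySlice hF s) (hardySlice hF t) =
      ∫ v, inner ℝ (slice F s v) (slice F t v) := by
  rw [hardySlice_of_pos hF hs, hardySlice_of_pos hF ht, L2.inner_def]
  rw [integral_congr_ae (g := fun q => inner ℝ (vertTranslate F s q) (vertTranslate F t q))]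
  · rw [beta, (measurableEmbedding_boundaryParam m).integral_map]
    rfl
  · filter_upwards [(hF.memLp hs).coeFn_toLp, (hF.memLp ht).coeFn_toLp] with q h1 h2
    rw [h1, h2]

theorem exists_norm_hardySlice_le (hF : MemHardy F) :
    ∃ M, ∀ t, 0 < t → ‖hardySlice hF t‖ ≤ M := by
  obtain ⟨hr, M, hM⟩ := memHardy_iff.1 hF
  refine ⟨M, fun t ht => ?_⟩
  rw [hardySlice_of_pos hF ht, Lp.norm_toLp]
  exact ENNReal.toReal_le_coe_of_le_coe (hM t ht)

theorem hardySlice_shift (hF : MemHardy F) (a b s : ℝ) (ha : 0 < a) (hs : 0 ≤ s) (hsb : s < b) :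
    inner ℝ (hardySlice hF (a + s)) (hardySlice hF (b - s)) =
      inner ℝ (hardySlice hF a) (hardySlice hF b) := by
  obtain ⟨M, hM⟩ := exists_norm_hardySlice_le hF
  rw [inner_hardySlice hF (by linarith) (by linarith), inner_hardySlice hF ha (by linarith)]
  refine integral_inner_slice_shift hF.1 (fun t ht => ?_) (B := M ^ 2) (fun t ht => ?_) ha hs hsb
  · have := hF.memLp ht
    exact (measurableEmbedding_boundaryParam m).memLp_map_measure_iff.1 this
  · have h1 := inner_hardySlice hF ht ht
    simp only [real_inner_self_eq_norm_sq] at h1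
    rw [← h1]
    have := hM t ht
    gcongr

theorem isBoundaryValue_iff (hF : MemHardy F) {g : HVec m → ℍ} (hg : MemLp g 2 (beta m)) :
    IsBoundaryValue F g ↔ Tendsto (hardySlice hF) (𝓝[>] 0) (𝓝 (hg.toLp g)) := by
  rw [IsBoundaryValue, and_iff_right hg, tendsto_iff_edist_tendsto_0]
  refine tendsto_congr' ?_
  filter_upwards [self_mem_nhdsWithin] with t ht
  rw [hardySlice_of_pos hF ht, Lp.edist_toLp_toLp]
  rfl

theorem exists_isBoundaryValue (hF : MemHardy F) : ∃ g, IsBoundaryValue F g := by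
  obtain ⟨M, hM⟩ := exists_norm_hardySlice_le hF
  obtain ⟨g, hg⟩ := exists_limit_of_shift (hardySlice_shift hF) hM
  refine ⟨g, (isBoundaryValue_iff hF (Lp.memLp g)).2 ?_⟩
  rwa [Lp.toLp_coeFn]

theorem IsBoundaryValue.ae_unique (hF : MemHardy F) {g g' : HVec m → ℍ}
    (hg : IsBoundaryValue F g) (hg' : IsBoundaryValue F g') : g =ᵐ[beta m] g' :=
  (MemLp.toLp_eq_toLp_iff hg.1 hg'.1).1 (tendsto_nhds_unique
    ((isBoundaryValue_iff hF hg.1).1 hg) ((isBoundaryValue_iff hF hg'.1).1 hg'))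

/-- The norms grow as the height decreases to `0`. Thus the norm of the boundary value can serve as
the uniform bound `M` in the interior estimates. -/
theorem eLpNorm_vertTranslate_le (hF : MemHardy F) {g : HVec m → ℍ} (hg : IsBoundaryValue F g)
    {t : ℝ} (ht : 0 < t) : eLpNorm (vertTranslate F t) 2 (beta m) ≤ eLpNorm g 2 (beta m) := by
  obtain ⟨M, hM⟩ := exists_norm_hardySlice_le hF
  have h := norm_le_limit_of_shift (hardySlice_shift hF) hM ((isBoundaryValue_iff hF hg.1).1 hg) ht
  rw [hardySlice_of_pos hF ht, Lp.norm_toLp, Lp.norm_toLp] at h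
  exact (ENNReal.toReal_le_toReal (hF.memLp ht).2.ne hg.1.2.ne).1 h

end

/-! ### Mean value property of regular functions -/

section

variable {m : ℕ}

/-- The square of the Euclidean norm on `ℍ^(m+1)`. -/
def euclidSq (y : HVec m) : ℝ := ∑ l, ‖y l‖ ^ 2

theorem contDiff_euclidSq {n : WithTop ℕ∞} : ContDiff ℝ n (euclidSq (m := m)) := by
  unfold euclidSq
  exact ContDiff.sum fun l _ => (contDiff_apply ℝ ℍ l).norm_sq ℝ

/-- The norm of `HVec m` is a supremum norm, whereas radial mollifiers depend on `euclidSq`; the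
comparison puts their supports inside norm balls. -/
theorem norm_sq_le_euclidSq (y : HVec m) : ‖y‖ ^ 2 ≤ euclidSq y := by
  obtain ⟨l, hl⟩ := Finite.exists_max fun l => ‖y l‖
  have h : ‖y‖ ≤ ‖y l‖ := (pi_norm_le_iff_of_nonneg (norm_nonneg _)).2 hl
  calc ‖y‖ ^ 2 ≤ ‖y l‖ ^ 2 := by gcongr
    _ ≤ euclidSq y := Finset.single_le_sum (f := fun l => ‖y l‖ ^ 2)
      (fun _ _ => by positivity) (Finset.mem_univ l)

theorem fderiv_euclidSq_single (y : HVec m) (l : Fin (m + 1)) (c : ℍ) :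
    fderiv ℝ euclidSq y (Pi.single l c) = 2 * inner ℝ (y l) c := by
  have h : HasFDerivAt (euclidSq (m := m)) (∑ l, (2 • (innerSL ℝ (y l))).comp
      (ContinuousLinearMap.proj (R := ℝ) (φ := fun _ : Fin (m + 1) => ℍ) l)) y := by
    unfold euclidSq
    refine HasFDerivAt.fun_sum fun l _ => ?_
    exact (hasStrictFDerivAt_norm_sq (y l)).hasFDerivAt.comp y
      (ContinuousLinearMap.proj (R := ℝ) (φ := fun _ : Fin (m + 1) => ℍ) l).hasFDerivAt
  rw [h.fderiv, _root_.sum_apply, Finset.sum_eq_single l]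
  · simp
  · intro b _ hb
    simp [Pi.single_eq_of_ne hb]
  · simp

/-- A radial mollifier `η` supported in the ball of radius `r`, together with a potential `ψ` with
gradient `y ↦ η(y) y`. -/
theorem exists_radial_mollifier (m : ℕ) {r : ℝ} (hr : 0 < r) : ∃ η ψ : HVec m → ℝ,
    ContDiff ℝ 1 η ∧ ContDiff ℝ 2 ψ ∧ (∀ y, r ≤ ‖y‖ → η y = 0) ∧ (∀ y, r ≤ ‖y‖ → ψ y = 0) ∧
    (∀ y, 0 ≤ η y) ∧ (∀ y, η y ≤ 1) ∧ (∀ y, η (-y) = η y) ∧ 0 < ∫ y, η y ∂(lebesgueH m) ∧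
    ∀ y l c, fderiv ℝ ψ y (Pi.single l c) = η y * inner ℝ (y l) c := by
  have hr2 : 0 < r ^ 2 := by positivity
  let φ : ContDiffBump (0 : ℝ) := ⟨r ^ 2 / 2, r ^ 2, by positivity, by linarith⟩
  have hφ : Continuous φ := φ.continuous
  have hφ0 : ∀ s, r ^ 2 ≤ s → φ s = 0 := fun s hs => φ.zero_of_le_dist (by
    rw [Real.dist_eq, sub_zero, abs_of_nonneg (by linarith)]; exact hs)
  -- A primitive of `φ` based at `r²`, hence zero beyond `r²`. With `η = φ(|y|²)` and `ψ =
  -- Θ(|y|²)/2`, the chain rule gives `∇ψ = η y`.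
  let Θ : ℝ → ℝ := fun s => ∫ x in (r ^ 2)..s, φ x
  have hΘ : ∀ s, HasDerivAt Θ (φ s) s := fun s => hφ.integral_hasStrictDerivAt _ s |>.hasDerivAt
  have hΘ0 : ∀ s, r ^ 2 ≤ s → Θ s = 0 := fun s hs => by
    refine intervalIntegral.integral_zero_ae (Eventually.of_forall fun x hx => ?_)
    rw [Set.uIoc_of_le hs] at hx
    exact hφ0 x hx.1.le
  have hΘd : ContDiff ℝ 2 Θ := by
    have h1 : deriv Θ = φ := funext fun s => (hΘ s).deriv
    rw [show (2 : WithTop ℕ∞) = 1 + 1 by norm_num, contDiff_succ_iff_deriv]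
    exact ⟨fun s => (hΘ s).differentiableAt, by simp, h1 ▸ φ.contDiff⟩
  have hle : ∀ y : HVec m, r ≤ ‖y‖ → r ^ 2 ≤ euclidSq y := fun y hy =>
    (by gcongr : r ^ 2 ≤ ‖y‖ ^ 2).trans (norm_sq_le_euclidSq y)
  have hη : ContDiff ℝ 1 fun y : HVec m => φ (euclidSq y) := φ.contDiff.comp contDiff_euclidSq
  refine ⟨fun y => φ (euclidSq y), fun y => Θ (euclidSq y) / 2, hη,
    (hΘd.comp contDiff_euclidSq).div_const 2, fun y hy => hφ0 _ (hle y hy),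
    fun y hy => by simp only [hΘ0 _ (hle y hy), zero_div],
    fun y => φ.nonneg, fun y => φ.le_one, fun y => by simp [euclidSq], ?_, fun y l c => ?_⟩
  · refine hη.continuous.integral_pos_of_hasCompactSupport_nonneg_nonzero (x := 0) ?_
      (fun y => φ.nonneg) ?_
    · refine HasCompactSupport.intro (isCompact_closedBall (0 : HVec m) r) fun y hy => ?_
      rw [mem_closedBall_zero_iff, not_le] at hy
      exact hφ0 _ (hle y hy.le)
    · have : φ (euclidSq (0 : HVec m)) = 1 := by
        refine φ.one_of_mem_closedBall ?_
        simp only [euclidSq, Pi.zero_apply, norm_zero, ne_eq, OfNat.ofNat_ne_zero,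
          not_false_eq_true, zero_pow, Finset.sum_const_zero]
        exact Metric.mem_closedBall_self φ.rIn_pos.le
      rw [this]
      exact one_ne_zero
  · have h1 : HasFDerivAt (euclidSq (m := m)) (fderiv ℝ euclidSq y) y :=
      ((contDiff_euclidSq (n := 1)).differentiable one_ne_zero y).hasFDerivAt
    have h2 := ((hΘ (euclidSq y)).comp_hasFDerivAt y h1).mul_const (1 / 2)
    have h3 : (fun y : HVec m => Θ (euclidSq y) / 2) = fun y => (Θ ∘ euclidSq) y * (1 / 2) := by
      funext y; simp [div_eq_mul_inv]
    rw [h3, h2.fderiv]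
    simp only [smul_apply, fderiv_euclidSq_single, smul_eq_mul]
    ring

/-- Both sides equal minus the integral of the mixed second derivative of `ψ` against `G`. All
second derivatives fall on `ψ`, since `G` is only `C¹`. -/
theorem integral_fderiv_smul_fderiv_symm {X E : Type*} [NormedAddCommGroup X] [NormedSpace ℝ X]
    [FiniteDimensional ℝ X] [MeasurableSpace X] [BorelSpace X] {μ : Measure X}
    [μ.IsAddHaarMeasure] [NormedAddCommGroup E] [NormedSpace ℝ E] {ψ : X → ℝ}
    (hψ : ContDiff ℝ 2 ψ) (hψc : HasCompactSupport ψ) {G : X → E} (hG : ContDiff ℝ 1 G) (u w : X) :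
    ∫ y, fderiv ℝ ψ y u • fderiv ℝ G y w ∂μ = ∫ y, fderiv ℝ ψ y w • fderiv ℝ G y u ∂μ := by
  have hd : ContDiff ℝ 1 (fderiv ℝ ψ) := hψ.fderiv_right (m := 1) (by norm_num)
  have hdu : ∀ u, ContDiff ℝ 1 fun y => fderiv ℝ ψ y u := fun u => hd.clm_apply contDiff_const
  have hc : ∀ u, HasCompactSupport fun y => fderiv ℝ ψ y u := fun u => hψc.fderiv_apply ℝ u
  have hGd : ∀ w, Continuous fun y => fderiv ℝ G y w := fun w =>
    (hG.continuous_fderiv one_ne_zero).clm_apply continuous_const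
  have key : ∀ u w, ∫ y, fderiv ℝ ψ y u • fderiv ℝ G y w ∂μ =
      -∫ y, fderiv ℝ (fderiv ℝ ψ) y w u • G y ∂μ := fun u w => by
    have h2 : ∀ y, fderiv ℝ (fun y => fderiv ℝ ψ y u) y w = fderiv ℝ (fderiv ℝ ψ) y w u :=
      fun y => by
        rw [fderiv_clm_apply (hd.differentiable one_ne_zero y) (differentiableAt_const u)]
        simp
    simp only [← h2]
    have hc2 : HasCompactSupport fun y => fderiv ℝ (fun y => fderiv ℝ ψ y u) y w :=
      (hc u).fderiv_apply ℝ w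
    refine integral_smul_fderiv_eq_neg_fderiv_smul_of_integrable ?_ ?_ ?_
      (fun y _ => (hdu u).differentiable one_ne_zero y)
      (fun y _ => hG.differentiable one_ne_zero y)
    · exact Continuous.integrable_of_hasCompactSupport
        ((((hdu u).continuous_fderiv one_ne_zero).clm_apply continuous_const).smul hG.continuous)
        hc2.smul_right
    · exact Continuous.integrable_of_hasCompactSupport
        ((hdu u).continuous.smul (hGd w)) (hc u).smul_right
    · exact Continuous.integrable_of_hasCompactSupport
        ((hdu u).continuous.smul hG.continuous) (hc u).smul_right
  rw [key, key]
  congr 2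
  funext y
  rw [(hψ.contDiffAt.isSymmSndFDerivAt (by simp)).eq]

/-- The algebra behind "conjugate operator times operator is the Laplacian": `a`, `b c`, `A c d`
stand for `∂_0∂_0`, `∂_0∂_c`, `∂_c∂_d`. In `∑ i_c i_d A c d` the off-diagonal terms cancel by
anticommutation and the diagonal ones give `-∑ A c c`. -/
theorem quat_sum_eq_zero_of_symm {A : Fin 3 → Fin 3 → ℍ} {a : ℍ} {b : Fin 3 → ℍ}
    (hA : ∀ c d, A c d = A d c) (h0 : a + ∑ c, imUnit c * b c = 0)
    (h : ∀ c, b c + ∑ d, imUnit d * A c d = 0) : a + ∑ c, A c c = 0 := by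
  have e : a + ∑ c, A c c = a + ∑ c, imUnit c * b c
      - ∑ c, imUnit c * (b c + ∑ d, imUnit d * A c d) := by
    simp only [Fin.sum_univ_three, imUnit_zero, imUnit_one, imUnit_two, hA 1 0, hA 2 0, hA 2 1]
    ext <;> simp <;> ring
  rw [e, h0]
  simp only [h, mul_zero, Finset.sum_const_zero, sub_zero]

/-- Weak harmonicity in the variable `l`. The Cauchy–Fueter equation is required only where the
`l`-gradient of `ψ` is nonzero, which allows `G` to be a cut-off regular function. -/
theorem integral_gradient_pairing_eq_zero {μ : Measure (HVec m)} [μ.IsAddHaarMeasure]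
    {ψ : HVec m → ℝ} (hψ : ContDiff ℝ 2 ψ) (hψc : HasCompactSupport ψ) {G : HVec m → ℍ}
    (hG : ContDiff ℝ 1 G) (l : Fin (m + 1))
    (h : ∀ y c, fderiv ℝ ψ y (Pi.single l c) ≠ 0 → cauchyFueter l G y = 0) :
    ∫ y, (fderiv ℝ ψ y (Pi.single l 1) • fderiv ℝ G y (Pi.single l 1)
      + ∑ c, fderiv ℝ ψ y (Pi.single l (imUnit c)) • fderiv ℝ G y (Pi.single l (imUnit c))) ∂μ
      = 0 := by
  have hint : ∀ u w, Integrable (fun y => fderiv ℝ ψ y u • fderiv ℝ G y w) μ := fun u w => by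
    have hc : HasCompactSupport fun y => fderiv ℝ ψ y u := hψc.fderiv_apply ℝ u
    exact Continuous.integrable_of_hasCompactSupport
      (((hψ.continuous_fderiv two_ne_zero).clm_apply continuous_const).smul
        ((hG.continuous_fderiv one_ne_zero).clm_apply continuous_const)) hc.smul_right
  have key : ∀ e : ℍ, ∫ y, fderiv ℝ ψ y (Pi.single l e) • fderiv ℝ G y (Pi.single l 1) ∂μ +
      ∑ d, imUnit d *
        ∫ y, fderiv ℝ ψ y (Pi.single l e) • fderiv ℝ G y (Pi.single l (imUnit d)) ∂μ = 0 := by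
    intro e
    have e1 : ∀ d, imUnit d *
        ∫ y, fderiv ℝ ψ y (Pi.single l e) • fderiv ℝ G y (Pi.single l (imUnit d)) ∂μ =
        ∫ y, imUnit d * fderiv ℝ ψ y (Pi.single l e) • fderiv ℝ G y (Pi.single l (imUnit d)) ∂μ :=
      fun d => (integral_const_mul_of_integrable (hint _ _)).symm
    simp only [e1]
    rw [← integral_finsetSum _ fun d _ => (hint _ _).const_mul _, ← integral_add (hint _ _)
      (integrable_finsetSum _ fun d _ => (hint _ _).const_mul _)]
    refine integral_eq_zero_of_ae (Eventually.of_forall fun y => ?_)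
    simp only [mul_smul_comm, ← Finset.smul_sum, ← smul_add, ← cauchyFueter_eq_sum, Pi.zero_apply]
    by_cases h0 : fderiv ℝ ψ y (Pi.single l e) = 0
    · rw [h0, zero_smul]
    · rw [h y e h0, smul_zero]
  rw [integral_add (hint _ _) (integrable_finsetSum _ fun d _ => hint _ _),
    integral_finsetSum _ fun d _ => hint _ _]
  refine quat_sum_eq_zero_of_symm (A := fun c d => ∫ y, fderiv ℝ ψ y (Pi.single l (imUnit c)) •
      fderiv ℝ G y (Pi.single l (imUnit d)) ∂μ)
    (fun c d => integral_fderiv_smul_fderiv_symm hψ hψc hG _ _) (key 1) fun c => ?_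
  have := key (imUnit c)
  rwa [integral_fderiv_smul_fderiv_symm hψ hψc hG] at this

theorem quat_eq_inner_sum (a : ℍ) :
    a = (inner ℝ a 1 : ℝ) • (1 : ℍ) + ∑ c, (inner ℝ a (imUnit c) : ℝ) • imUnit c := by
  simp only [Fin.sum_univ_three, imUnit_zero, imUnit_one, imUnit_two, Quaternion.inner_def]
  ext <;> simp

theorem eq_inner_smul_sum (y : HVec m) : y = ∑ l, (inner ℝ (y l) 1 • (Pi.single l 1 : HVec m)
    + ∑ c, inner ℝ (y l) (imUnit c) • (Pi.single l (imUnit c) : HVec m)) := by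
  conv_lhs => rw [← Finset.univ_sum_single y]
  refine Finset.sum_congr rfl fun l _ => ?_
  conv_lhs => rw [quat_eq_inner_sum (y l)]
  simp only [← Pi.single_smul, Fin.sum_univ_three, ← Pi.single_add]

theorem fderiv_comp_dilation {G : HVec m → ℍ} (hG : Differentiable ℝ G) (q y : HVec m)
    (ρ : ℝ) (u : HVec m) :
    fderiv ℝ (fun y => G (q + ρ • y)) y u = ρ • fderiv ℝ G (q + ρ • y) u := by
  have h1 : HasFDerivAt (fun y : HVec m => q + ρ • y)
      (ρ • ContinuousLinearMap.id ℝ (HVec m)) y :=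
    ((hasFDerivAt_id y).const_smul ρ).const_add q
  have h2 := (hG (q + ρ • y)).hasFDerivAt.comp y h1
  rw [show (fun y => G (q + ρ • y)) = G ∘ fun y => q + ρ • y from rfl, h2.fderiv]
  simp

theorem cauchyFueter_comp_dilation {G : HVec m → ℍ} (hG : Differentiable ℝ G) (q y : HVec m)
    (ρ : ℝ) (l : Fin (m + 1)) :
    cauchyFueter l (fun y => G (q + ρ • y)) y = ρ • cauchyFueter l G (q + ρ • y) := by
  simp only [cauchyFueter_eq_sum, fderiv_comp_dilation hG, smul_add, Finset.smul_sum,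
    mul_smul_comm]

theorem hasCompactSupport_of_norm {E : Type*} [Zero E] {η : HVec m → E} {r : ℝ}
    (h : ∀ y, r ≤ ‖y‖ → η y = 0) : HasCompactSupport η :=
  HasCompactSupport.intro (isCompact_closedBall (0 : HVec m) r) fun y hy =>
    h y (by rw [mem_closedBall_zero_iff, not_le] at hy; exact hy.le)

/-- The mean value property with respect to radial mollifiers, for globally defined functions. -/
theorem integral_mollifier_smul_of_contDiff {r : ℝ} {η ψ : HVec m → ℝ}
    (hη : ContDiff ℝ 1 η) (hψ : ContDiff ℝ 2 ψ) (hη0 : ∀ y, r ≤ ‖y‖ → η y = 0)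
    (hψ0 : ∀ y, r ≤ ‖y‖ → ψ y = 0)
    (hψη : ∀ y l c, fderiv ℝ ψ y (Pi.single l c) = η y * inner ℝ (y l) c)
    {G : HVec m → ℍ} (hG : ContDiff ℝ 1 G) {q : HVec m}
    (hreg : ∀ p ∈ Metric.closedBall q r, ∀ l, cauchyFueter l G p = 0) :
    ∫ y, η y • G (q + y) ∂(lebesgueH m) = (∫ y, η y ∂(lebesgueH m)) • G q := by
  have hGd : Differentiable ℝ G := hG.differentiable one_ne_zero
  set J : ℝ → ℍ := fun ρ => ∫ y, η y • G (q + ρ • y) ∂(lebesgueH m) with hJ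
  have hder : ∀ ρ, HasDerivAt J (∫ y, η y • fderiv ℝ G (q + ρ • y) y ∂(lebesgueH m)) ρ := by
    intro ρ
    refine hasDerivAt_integral_of_compact (isCompact_closedBall (0 : HVec m) r) isOpen_univ
      (Set.mem_univ ρ) (g := fun ρ y => η y • G (q + ρ • y))
      (g' := fun ρ y => η y • fderiv ℝ G (q + ρ • y) y) ?_ ?_ ?_ ?_ ?_
    · intro s _
      have := hη.continuous
      have := hG.continuous
      fun_prop
    · intro s _ y hy
      rw [mem_closedBall_zero_iff, not_le] at hy
      rw [hη0 y hy.le, zero_smul]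
    · have h1 := hη.continuous
      have h2 := hG.continuous_fderiv one_ne_zero
      refine Continuous.continuousOn ?_
      unfold Function.uncurry
      refine (h1.comp continuous_snd).smul (Continuous.clm_apply (h2.comp ?_) continuous_snd)
      fun_prop
    · intro s _ y hy
      rw [mem_closedBall_zero_iff, not_le] at hy
      rw [hη0 y hy.le, zero_smul]
    · intro s _ y
      have h1 : HasDerivAt (fun s : ℝ => q + s • y) y s := by
        simpa using ((hasDerivAt_id s).smul_const y).const_add q
      exact ((hGd (q + s • y)).hasFDerivAt.comp_hasDerivAt s h1).const_smul (η y)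
  have hzero : ∀ ρ : ℝ, 0 < ρ → ρ ≤ 1 →
      ∫ y, η y • fderiv ℝ G (q + ρ • y) y ∂(lebesgueH m) = 0 := by
    intro ρ h0 h1
    have hGρ : ContDiff ℝ 1 fun y : HVec m => G (q + ρ • y) := hG.comp (by fun_prop)
    have hψc := hasCompactSupport_of_norm hψ0
    -- Since `η y` is the gradient of `ψ`, the radial derivative of `G` is a gradient pairing; the
    -- factor `ρ` comes from differentiating the dilated function.
    have hsum : ∀ y, ρ • (η y • fderiv ℝ G (q + ρ • y) y) = ∑ l,
        (fderiv ℝ ψ y (Pi.single l 1) • fderiv ℝ (fun y => G (q + ρ • y)) y (Pi.single l 1)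
        + ∑ c, fderiv ℝ ψ y (Pi.single l (imUnit c)) •
          fderiv ℝ (fun y => G (q + ρ • y)) y (Pi.single l (imUnit c))) := fun y => by
      conv_lhs => enter [2, 2, 2]; rw [eq_inner_smul_sum y]
      simp only [map_sum, map_add, map_smul, hψη, fderiv_comp_dilation hGd, Finset.smul_sum,
        smul_add, smul_smul]
      refine Finset.sum_congr rfl fun l _ => ?_
      congr 1
      · congr 1; ring
      · refine Finset.sum_congr rfl fun c _ => ?_
        congr 1; ring
    have hint : ∀ u w, Integrable (fun y => fderiv ℝ ψ y u •
        fderiv ℝ (fun y => G (q + ρ • y)) y w) (lebesgueH m) := fun u w => by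
      have hc : HasCompactSupport fun y => fderiv ℝ ψ y u := hψc.fderiv_apply ℝ u
      exact Continuous.integrable_of_hasCompactSupport
        (((hψ.continuous_fderiv two_ne_zero).clm_apply continuous_const).smul
          ((hGρ.continuous_fderiv one_ne_zero).clm_apply continuous_const)) hc.smul_right
    refine (smul_eq_zero.1 (?_ : ρ • _ = (0 : ℍ))).resolve_left h0.ne'
    rw [← integral_smul]
    simp only [hsum]
    refine (integral_finsetSum _ fun l _ => ?_).trans (Finset.sum_eq_zero fun l _ => ?_)
    · exact (hint _ _).add (integrable_finsetSum _ fun c _ => hint _ _)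
    refine integral_gradient_pairing_eq_zero hψ hψc hGρ l fun y c hy => ?_
    have hyr : ‖y‖ < r := by
      by_contra! hc
      rw [hψη, hη0 y hc, zero_mul] at hy
      exact hy rfl
    rw [cauchyFueter_comp_dilation hGd, hreg _ _ l, smul_zero]
    rw [mem_closedBall_iff_norm, add_sub_cancel_left, norm_smul, Real.norm_of_nonneg h0.le]
    nlinarith [norm_nonneg y]
  have hconst : ∀ ρ ∈ Set.Ioc (0 : ℝ) 1, J 1 = J ρ := fun ρ hρ => by
    have := (convex_Ioc (0 : ℝ) 1).norm_image_sub_le_of_norm_hasDerivWithin_le (C := 0)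
      (fun σ _ => (hder σ).hasDerivWithinAt) (fun σ hσ => by rw [hzero σ hσ.1 hσ.2, norm_zero])
      hρ (Set.right_mem_Ioc.2 one_pos)
    rw [zero_mul] at this
    exact sub_eq_zero.1 (norm_le_zero_iff.1 this)
  -- The vanishing of `J'` was obtained by cancelling `ρ`, so only for `ρ > 0`; the value at `0` is
  -- reached by continuity.
  have h01 : J 1 = J 0 := by
    refine tendsto_nhds_unique (f := J) (l := 𝓝[>] 0) ?_
      ((hder 0).continuousAt.tendsto.mono_left nhdsWithin_le_nhds)
    refine tendsto_const_nhds.congr' ?_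
    filter_upwards [Ioc_mem_nhdsGT one_pos] with ρ hρ using hconst ρ hρ
  simp only [hJ, one_smul, zero_smul, add_zero] at h01
  rw [h01, integral_smul_const]

theorem cauchyFueter_congr {f g : HVec m → ℍ} {q : HVec m} (h : f =ᶠ[𝓝 q] g)
    (l : Fin (m + 1)) : cauchyFueter l f q = cauchyFueter l g q := by
  simp only [cauchyFueter, h.fderiv_eq]

/-- The mean value property of regular functions with respect to radial mollifiers. -/
theorem IsRegularOn.integral_mollifier_smul {r : ℝ} (hr : 0 < r) {η ψ : HVec m → ℝ}
    (hη : ContDiff ℝ 1 η) (hψ : ContDiff ℝ 2 ψ) (hη0 : ∀ y, r ≤ ‖y‖ → η y = 0)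
    (hψ0 : ∀ y, r ≤ ‖y‖ → ψ y = 0)
    (hψη : ∀ y l c, fderiv ℝ ψ y (Pi.single l c) = η y * inner ℝ (y l) c)
    {U : Set (HVec m)} (hU : IsOpen U) {F : HVec m → ℍ} (hF : IsRegularOn F U) {q : HVec m}
    (hq : Metric.closedBall q (2 * r) ⊆ U) :
    ∫ y, η y • F (q + y) ∂(lebesgueH m) = (∫ y, η y ∂(lebesgueH m)) • F q := by
  -- The cutoff is `1` on a neighbourhood of `closedBall q r`, where the equations are needed, and
  -- its support `closedBall q (2 * r)` lies in `U`, so `χ • F` is `C¹` everywhere.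
  let χ : ContDiffBump q := ⟨3 / 2 * r, 2 * r, by positivity, by linarith⟩
  have hG : ContDiff ℝ 1 fun p => χ p • F p := by
    rw [contDiff_iff_contDiffAt]
    intro p
    by_cases hp : p ∈ U
    · exact χ.contDiffAt.smul (hF.1.contDiffAt (hU.mem_nhds hp))
    · have h1 : p ∉ tsupport χ := fun h => hp (hq (by rwa [χ.tsupport_eq] at h))
      refine (contDiffAt_const (c := (0 : ℍ))).congr_of_eventuallyEq ?_
      filter_upwards [notMem_tsupport_iff_eventuallyEq.1 h1] with x hx
      rw [hx, Pi.zero_apply, zero_smul]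
  have hEq : ∀ p ∈ Metric.closedBall q r, (fun p => χ p • F p) =ᶠ[𝓝 p] F := fun p hp => by
    have h1 : p ∈ Metric.ball q χ.rIn := Metric.closedBall_subset_ball
      (show r < 3 / 2 * r by linarith) hp
    filter_upwards [χ.eventuallyEq_one_of_mem_ball h1] with x hx
    rw [hx, Pi.one_apply, one_smul]
  have h := integral_mollifier_smul_of_contDiff hη hψ hη0 hψ0 hψη hG (q := q) fun p hp l => by
    rw [cauchyFueter_congr (hEq p hp)]
    exact hF.2 l p (hq (Metric.closedBall_subset_closedBall (by linarith) hp))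
  have hqe := (hEq q (Metric.mem_closedBall_self hr.le)).self_of_nhds
  dsimp only at hqe
  rw [hqe] at h
  rw [← h]
  congr 1
  funext y
  by_cases hy : r ≤ ‖y‖
  · rw [hη0 y hy, zero_smul, zero_smul]
  · exact congrArg (η y • ·)
      (hEq (q + y) (by simpa using (not_le.1 hy).le)).self_of_nhds.symm

end

/-! ### Sums and right multiples of Hardy functions -/

section

variable {m : ℕ} {F G : HVec m → ℍ}

theorem cauchyFueter_add {q : HVec m} (hF : DifferentiableAt ℝ F q) (hG : DifferentiableAt ℝ G q)
    (l : Fin (m + 1)) :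
    cauchyFueter l (fun q => F q + G q) q = cauchyFueter l F q + cauchyFueter l G q := by
  simp only [cauchyFueter, fderiv_fun_add hF hG, _root_.add_apply, mul_add]
  abel

/-- The operator multiplies by units on the left, so it commutes with right multiplication; the
Hardy space is thereby a right `ℍ`-module. -/
theorem cauchyFueter_mul_const {q : HVec m} (hF : DifferentiableAt ℝ F q) (c : ℍ)
    (l : Fin (m + 1)) : cauchyFueter l (fun q => F q * c) q = cauchyFueter l F q * c := by
  have h : ∀ u, fderiv ℝ (fun q => F q * c) q u = fderiv ℝ F q u * c := fun u => by
    rw [(hF.hasFDerivAt.mul_const' c).fderiv]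
    simp
  simp only [cauchyFueter, h, add_mul, mul_assoc]

theorem IsRegularOn.add {U : Set (HVec m)} (hU : IsOpen U) (hF : IsRegularOn F U)
    (hG : IsRegularOn G U) : IsRegularOn (fun q => F q + G q) U :=
  ⟨hF.1.add hG.1, fun l q hq => by
    rw [cauchyFueter_add (hF.differentiableAt hU hq) (hG.differentiableAt hU hq), hF.2 l q hq,
      hG.2 l q hq, add_zero]⟩

theorem IsRegularOn.mul_const {U : Set (HVec m)} (hU : IsOpen U) (hF : IsRegularOn F U) (c : ℍ) :
    IsRegularOn (fun q => F q * c) U :=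
  ⟨hF.1.mul contDiffOn_const, fun l q hq => by
    rw [cauchyFueter_mul_const (hF.differentiableAt hU hq), hF.2 l q hq, zero_mul]⟩

theorem MemHardy.add (hF : MemHardy F) (hG : MemHardy G) : MemHardy fun q => F q + G q := by
  obtain ⟨-, M, hM⟩ := memHardy_iff.1 hF
  obtain ⟨-, N, hN⟩ := memHardy_iff.1 hG
  refine memHardy_iff.2 ⟨hF.1.add (isOpen_siegel m) hG.1, M + N, fun t ht => ?_⟩
  rw [ENNReal.coe_add]
  exact (eLpNorm_add_le (hF.memLp ht).1 (hG.memLp ht).1 one_le_two).trans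
    (add_le_add (hM t ht) (hN t ht))

theorem eLpNorm_mul_const_le {α : Type*} [MeasurableSpace α] {μ : Measure α} (f : α → ℍ) (c : ℍ) :
    eLpNorm (fun x => f x * c) 2 μ ≤ ‖c‖₊ * eLpNorm f 2 μ := by
  refine eLpNorm_le_nnreal_smul_eLpNorm_of_ae_le_mul (Eventually.of_forall fun x => ?_) 2
  rw [nnnorm_mul, mul_comm]

theorem MemHardy.mul_const (hF : MemHardy F) (c : ℍ) : MemHardy fun q => F q * c := by
  obtain ⟨-, M, hM⟩ := memHardy_iff.1 hF
  refine memHardy_iff.2 ⟨hF.1.mul_const (isOpen_siegel m) c, ‖c‖₊ * M, fun t ht => ?_⟩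
  rw [ENNReal.coe_mul]
  exact (eLpNorm_mul_const_le _ c).trans (by gcongr; exact hM t ht)

theorem memLp_mul_const {α : Type*} [MeasurableSpace α] {μ : Measure α} {g : α → ℍ}
    (hg : MemLp g 2 μ) (c : ℍ) : MemLp (fun x => g x * c) 2 μ :=
  ⟨hg.1.mul_const c, (eLpNorm_mul_const_le _ c).trans_lt (ENNReal.mul_lt_top (by simp) hg.2)⟩

theorem IsBoundaryValue.add (hF : MemHardy F) (hG : MemHardy G) {f g : HVec m → ℍ}
    (hf : IsBoundaryValue F f) (hg : IsBoundaryValue G g) :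
    IsBoundaryValue (fun q => F q + G q) (fun q => f q + g q) := by
  refine ⟨hf.1.add hg.1, ?_⟩
  have h := hf.2.add hg.2
  rw [add_zero] at h
  refine tendsto_of_tendsto_of_tendsto_of_le_of_le' tendsto_const_nhds h
    (Eventually.of_forall fun _ => zero_le) ?_
  filter_upwards [self_mem_nhdsWithin] with t ht
  refine le_trans (le_of_eq ?_) (eLpNorm_add_le ((hF.memLp ht).1.sub hf.1.1)
    ((hG.memLp ht).1.sub hg.1.1) one_le_two)
  congr 1
  funext q
  simp only [Pi.add_apply, vertTranslate]
  abel

theorem IsBoundaryValue.mul_const {f : HVec m → ℍ} (hf : IsBoundaryValue F f) (c : ℍ) :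
    IsBoundaryValue (fun q => F q * c) (fun q => f q * c) := by
  refine ⟨memLp_mul_const hf.1 c, ?_⟩
  have h := ENNReal.Tendsto.const_mul (a := (‖c‖₊ : ℝ≥0∞)) hf.2 (Or.inr ENNReal.coe_ne_top)
  rw [mul_zero] at h
  refine tendsto_of_tendsto_of_tendsto_of_le_of_le tendsto_const_nhds h
    (fun _ => zero_le) fun t => ?_
  refine le_trans (le_of_eq ?_) (eLpNorm_mul_const_le _ c)
  congr 1
  funext q
  simp only [vertTranslate, sub_mul]

theorem IsBoundaryValue.congr_ae {f g : HVec m → ℍ} (hf : IsBoundaryValue F f)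
    (h : f =ᵐ[beta m] g) : IsBoundaryValue F g := by
  refine ⟨hf.1.ae_eq h, hf.2.congr fun t => eLpNorm_congr_ae ?_⟩
  filter_upwards [h] with q hq
  rw [hq]

theorem MemHardy.sub (hF : MemHardy F) (hG : MemHardy G) : MemHardy fun q => F q - G q := by
  have h := hF.add (hG.mul_const (-1))
  simpa only [mul_neg, mul_one, ← sub_eq_add_neg] using h

theorem IsBoundaryValue.sub (hF : MemHardy F) (hG : MemHardy G) {f g : HVec m → ℍ}
    (hf : IsBoundaryValue F f) (hg : IsBoundaryValue G g) :
    IsBoundaryValue (fun q => F q - G q) (fun q => f q - g q) := by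
  have h := hf.add hF (hG.mul_const (-1)) (hg.mul_const (-1))
  simpa only [mul_neg, mul_one, ← sub_eq_add_neg] using h

/-! ### Interior estimates, limits, and closedness of the boundary values -/

/-- Fubini over the height: each level contributes at most `M²`, and `B` meets only levels in `(0,
b]`. -/
theorem setLIntegral_sq_le {M : ℝ≥0∞}
    (hM : ∀ t, 0 < t → eLpNorm (vertTranslate F t) 2 (beta m) ≤ M) {B : Set (HVec m)}
    (hB : MeasurableSet B) {b : ℝ} (hBb : ∀ q ∈ B, 0 < height q ∧ height q ≤ b) :
    ∫⁻ q in B, ‖F q‖ₑ ^ 2 ∂(lebesgueH m) ≤ ENNReal.ofReal b * M ^ 2 := by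
  rw [← lintegral_indicator hB, ← (measurePreserving_heightPoint m).map_eq]
  refine (lintegral_map_le _ _).trans ?_
  rw [← lintegral_prod_swap]
  refine (lintegral_prod_le _).trans ?_
  calc ∫⁻ t : ℝ, ∫⁻ v : HeisCoord m, B.indicator (fun q => ‖F q‖ₑ ^ 2) (heightPoint v t)
      ≤ ∫⁻ t : ℝ, (Set.Ioc 0 b).indicator (fun _ => M ^ 2) t := by
        refine lintegral_mono fun t => ?_
        by_cases ht : t ∈ Set.Ioc 0 b
        · rw [Set.indicator_of_mem ht]
          calc ∫⁻ v : HeisCoord m, B.indicator (fun q => ‖F q‖ₑ ^ 2) (heightPoint v t)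
              ≤ ∫⁻ v, ‖slice F t v‖ₑ ^ 2 :=
                lintegral_mono fun v => Set.indicator_le_self' (fun _ _ => zero_le) _
            _ = eLpNorm (slice F t) 2 volume ^ 2 := (eLpNorm_two_sq _).symm
            _ ≤ M ^ 2 := by
              rw [← eLpNorm_vertTranslate]
              gcongr
              exact hM t ht.1
        · rw [Set.indicator_of_notMem ht]
          refine le_of_eq (lintegral_eq_zero_of_ae_eq_zero (Eventually.of_forall fun v => ?_))
          refine Set.indicator_of_notMem (fun hv => ht ?_) _
          have := hBb _ hv
          rwa [height_heightPoint] at this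
    _ = ENNReal.ofReal b * M ^ 2 := by
        rw [lintegral_indicator measurableSet_Ioc, setLIntegral_const, Real.volume_Ioc, sub_zero,
          mul_comm]

/-- Local uniform boundedness of Hardy functions by their norm. -/
theorem exists_local_bound {q : HVec m} (hq : q ∈ siegel m) : ∃ r > 0,
    Metric.closedBall q (4 * r) ⊆ siegel m ∧ ∃ C : NNReal, ∀ F : HVec m → ℍ,
      IsRegularOn F (siegel m) → ∀ M : ℝ≥0∞,
      (∀ t, 0 < t → eLpNorm (vertTranslate F t) 2 (beta m) ≤ M) →
      ∀ p ∈ Metric.closedBall q (2 * r), ‖F p‖ₑ ≤ C * M := by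
  obtain ⟨R, hR, hRU⟩ := Metric.nhds_basis_closedBall.mem_iff.1 ((isOpen_siegel m).mem_nhds hq)
  have hr : 0 < R / 4 := by positivity
  set r := R / 4 with hrdef
  have hRU' : Metric.closedBall q (4 * r) ⊆ siegel m := by
    rwa [show 4 * r = R by rw [hrdef]; ring]
  set B := Metric.closedBall q (4 * r) with hB
  have hBc : IsCompact B := isCompact_closedBall _ _
  obtain ⟨b, hb⟩ := hBc.exists_bound_of_continuousOn (continuous_height m).continuousOn
  obtain ⟨η, ψ, hη, hψ, hη0, hψ0, hηn, hη1, -, hκ, hψη⟩ := exists_radial_mollifier m hr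
  set κ := ∫ y, η y ∂(lebesgueH m) with hκdef
  have hfin : lebesgueH m B ^ (1 / 2 : ℝ) * ENNReal.ofReal b ^ (1 / 2 : ℝ) ≠ ∞ := by
    have := hBc.measure_lt_top (μ := lebesgueH m)
    finiteness
  -- The factor `κ⁻¹` comes from the mean value property, the root of the volume of `B` from
  -- Cauchy–Schwarz, and `b^(1/2)` from `setLIntegral_sq_le`.
  refine ⟨r, hr, hRU', (‖κ‖ₑ⁻¹ * (lebesgueH m B ^ (1 / 2 : ℝ) *
    ENNReal.ofReal b ^ (1 / 2 : ℝ))).toNNReal, fun F hF M hM p hp => ?_⟩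
  have hκ0 : ‖κ‖ₑ ≠ 0 := by simpa using hκ.ne'
  rw [ENNReal.coe_toNNReal (ENNReal.mul_ne_top (ENNReal.inv_ne_top.2 hκ0) hfin)]
  have hpB : Metric.closedBall p (2 * r) ⊆ siegel m := by
    refine subset_trans (Metric.closedBall_subset_closedBall' ?_) hRU'
    linarith [Metric.mem_closedBall.1 hp]
  have hmv := hF.integral_mollifier_smul hr hη hψ hη0 hψ0 hψη (isOpen_siegel m) hpB
  have hmeas : AEStronglyMeasurable F ((lebesgueH m).restrict B) :=
    (hF.1.continuousOn.mono hRU').aestronglyMeasurable hBc.measurableSet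
  have h2 : eLpNorm F 2 ((lebesgueH m).restrict B) ≤ ENNReal.ofReal b ^ (1 / 2 : ℝ) * M := by
    have h3 := setLIntegral_sq_le hM hBc.measurableSet (b := b) fun x hx =>
      ⟨mem_siegel_iff.1 (hRU' hx), (le_abs_self _).trans (hb x hx)⟩
    rw [← eLpNorm_two_sq] at h3
    have h4 := ENNReal.rpow_le_rpow h3 (show (0 : ℝ) ≤ 1 / 2 by norm_num)
    have hs : ∀ x : ℝ≥0∞, (x ^ 2) ^ (1 / 2 : ℝ) = x := fun x => by
      rw [← ENNReal.rpow_natCast, ← ENNReal.rpow_mul]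
      norm_num
    rwa [ENNReal.mul_rpow_of_nonneg _ _ (by norm_num), hs, hs] at h4
  have h1 : ‖κ‖ₑ * ‖F p‖ₑ ≤ lebesgueH m B ^ (1 / 2 : ℝ) * (ENNReal.ofReal b ^ (1 / 2 : ℝ) * M) :=
    calc ‖κ‖ₑ * ‖F p‖ₑ = ‖∫ y, η y • F (p + y) ∂(lebesgueH m)‖ₑ := by rw [hmv, enorm_smul]
      _ ≤ ∫⁻ y, ‖η y • F (p + y)‖ₑ ∂(lebesgueH m) := enorm_integral_le_lintegral_enorm _
      _ ≤ ∫⁻ y, B.indicator (fun z => ‖F z‖ₑ) (p + y) ∂(lebesgueH m) := by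
        refine lintegral_mono fun y => ?_
        by_cases hy : r ≤ ‖y‖
        · simp [hη0 y hy]
        · have hmem : p + y ∈ B := by
            have h5 := Metric.mem_closedBall.1 hp
            rw [hB, Metric.mem_closedBall]
            have h6 := dist_triangle (p + y) p q
            rw [dist_self_add_left] at h6
            linarith
          rw [Set.indicator_of_mem hmem, enorm_smul]
          refine mul_le_of_le_one_left zero_le ?_
          rw [Real.enorm_eq_ofReal (hηn y)]
          exact ENNReal.ofReal_le_one.2 (hη1 y)
      _ = ∫⁻ z in B, ‖F z‖ₑ ∂(lebesgueH m) := by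
        rw [lintegral_add_left_eq_self (μ := lebesgueH m)
          (fun z => B.indicator (fun z => ‖F z‖ₑ) z) p, lintegral_indicator hBc.measurableSet]
      _ = eLpNorm F 1 ((lebesgueH m).restrict B) := eLpNorm_one_eq_lintegral_enorm.symm
      _ ≤ eLpNorm F 2 ((lebesgueH m).restrict B) *
          (lebesgueH m).restrict B Set.univ ^ (1 / (1 : ℝ≥0∞).toReal - 1 / (2 : ℝ≥0∞).toReal) :=
        eLpNorm_le_eLpNorm_mul_rpow_measure_univ one_le_two hmeas
      _ = lebesgueH m B ^ (1 / 2 : ℝ) * eLpNorm F 2 ((lebesgueH m).restrict B) := by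
        rw [Measure.restrict_apply_univ, mul_comm]
        norm_num
      _ ≤ _ := by gcongr
  calc ‖F p‖ₑ = ‖κ‖ₑ⁻¹ * (‖κ‖ₑ * ‖F p‖ₑ) := by
        rw [← mul_assoc, ENNReal.inv_mul_cancel hκ0 enorm_ne_top, one_mul]
    _ ≤ _ := by
        rw [mul_assoc, mul_assoc]
        gcongr

/-- A uniformly locally bounded pointwise limit of regular functions is regular. -/
theorem isRegularOn_of_tendsto {U : Set (HVec m)} (hU : IsOpen U) {Fs : ℕ → HVec m → ℍ}
    (hFs : ∀ k, IsRegularOn (Fs k) U)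
    (hlim : ∀ p ∈ U, Tendsto (fun k => Fs k p) atTop (𝓝 (F p)))
    (hbd : ∀ q ∈ U, ∃ r > 0, Metric.closedBall q (4 * r) ⊆ U ∧
      ∃ A : ℝ, ∀ k, ∀ p ∈ Metric.closedBall q (2 * r), ‖Fs k p‖ ≤ A) :
    IsRegularOn F U := by
  suffices H : ∀ q ∈ U, ContDiffAt ℝ 1 F q ∧
      ∀ u, Tendsto (fun k => fderiv ℝ (Fs k) q u) atTop (𝓝 (fderiv ℝ F q u)) by
    refine ⟨fun q hq => (H q hq).1.contDiffWithinAt, fun l q hq => ?_⟩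
    have h := (H q hq).2
    have h1 : Tendsto (fun k => cauchyFueter l (Fs k) q) atTop (𝓝 (cauchyFueter l F q)) :=
      (((h _).add ((h _).const_mul _)).add ((h _).const_mul _)).add ((h _).const_mul _)
    refine tendsto_nhds_unique h1 (tendsto_const_nhds.congr fun k => ?_)
    rw [(hFs k).2 l q hq]
  intro q hq
  obtain ⟨r, hr, hrU, A, hA⟩ := hbd q hq
  obtain ⟨η, ψ, hη, hψ, hη0, hψ0, hηn, hη1, hηe, hκ, hψη⟩ := exists_radial_mollifier m hr
  set κ := ∫ y, η y ∂(lebesgueH m) with hκdef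
  set B := Metric.closedBall q (2 * r) with hB
  have hBc : IsCompact B := isCompact_closedBall _ _
  have hBU : B ⊆ U := (Metric.closedBall_subset_closedBall (by linarith)).trans hrU
  have hηc := hasCompactSupport_of_norm hη0
  let L : ℍ →L[ℝ] ℝ →L[ℝ] ℍ := (ContinuousLinearMap.lsmul ℝ ℝ).flip
  have hilim : ∀ z, Tendsto (fun k => B.indicator (Fs k) z) atTop (𝓝 (B.indicator F z)) := by
    intro z
    by_cases hz : z ∈ B
    · simpa only [Set.indicator_of_mem hz] using hlim z (hBU hz)
    · simp only [Set.indicator_of_notMem hz, tendsto_const_nhds]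
  have him : ∀ k, AEStronglyMeasurable (B.indicator (Fs k)) (lebesgueH m) := fun k =>
    (aestronglyMeasurable_indicator_iff hBc.measurableSet).2
      (((hFs k).1.continuousOn.mono hBU).aestronglyMeasurable hBc.measurableSet)
  have him' : AEStronglyMeasurable (B.indicator F) (lebesgueH m) :=
    aestronglyMeasurable_of_tendsto_ae atTop him (Eventually.of_forall hilim)
  have hAint : Integrable (B.indicator fun _ => A) (lebesgueH m) :=
    (integrable_indicator_iff hBc.measurableSet).2 (integrableOn_const hBc.measure_lt_top.ne)
  have hle : ∀ k z, ‖B.indicator (Fs k) z‖ ≤ B.indicator (fun _ => A) z := fun k z => by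
    by_cases hz : z ∈ B
    · simpa only [Set.indicator_of_mem hz] using hA k z hz
    · simp only [Set.indicator_of_notMem hz, norm_zero, le_refl]
  have hle' : ∀ z, ‖B.indicator F z‖ ≤ B.indicator (fun _ => A) z := fun z =>
    le_of_tendsto' (hilim z).norm fun k => hle k z
  have hint : ∀ k, LocallyIntegrable (B.indicator (Fs k)) (lebesgueH m) := fun k =>
    (hAint.mono' (him k) (Eventually.of_forall (hle k))).locallyIntegrable
  have hint' : LocallyIntegrable (B.indicator F) (lebesgueH m) :=
    (hAint.mono' him' (Eventually.of_forall hle')).locallyIntegrable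
  have hconv : ∀ h : HVec m → ℝ, Continuous h → (∃ K, ∀ z, ‖h z‖ ≤ K) →
      Tendsto (fun k => ∫ z, h z • B.indicator (Fs k) z ∂(lebesgueH m)) atTop
        (𝓝 (∫ z, h z • B.indicator F z ∂(lebesgueH m))) := by
    rintro h hh ⟨K, hK⟩
    refine tendsto_integral_of_dominated_convergence (fun z => K * B.indicator (fun _ => A) z)
      (fun k => hh.aestronglyMeasurable.smul (him k)) (hAint.const_mul K)
      (fun k => Eventually.of_forall fun z => ?_)
      (Eventually.of_forall fun z => (hilim z).const_smul (h z))
    rw [norm_smul]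
    exact mul_le_mul (hK z) (hle k z) (norm_nonneg _) ((norm_nonneg _).trans (hK z))
  -- By evenness of `η` the mean value property is a convolution identity. Derivatives then fall on
  -- `η`, so dominated convergence of the functions already yields convergence of their first
  -- derivatives.
  have hrepr : ∀ k, ∀ p ∈ Metric.ball q r, Fs k p =
      κ⁻¹ • convolution (B.indicator (Fs k)) η L (lebesgueH m) p := fun k p hp => by
    have hpB : Metric.closedBall p (2 * r) ⊆ U := by
      refine subset_trans (Metric.closedBall_subset_closedBall' ?_) hrU
      linarith [Metric.mem_ball.1 hp]
    have hmv := (hFs k).integral_mollifier_smul hr hη hψ hη0 hψ0 hψη hU hpB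
    have h1 : convolution (B.indicator (Fs k)) η L (lebesgueH m) p =
        ∫ y, η y • Fs k (p + y) ∂(lebesgueH m) := by
      rw [convolution, ← integral_add_left_eq_self _ p]
      refine integral_congr_ae (Eventually.of_forall fun y => ?_)
      simp only [L, ContinuousLinearMap.flip_apply, ContinuousLinearMap.lsmul_apply,
        sub_add_cancel_left, hηe]
      by_cases hy : r ≤ ‖y‖
      · simp only [hη0 y hy, zero_smul]
      · rw [Set.indicator_of_mem]
        rw [hB, Metric.mem_closedBall]
        have h6 := dist_triangle (p + y) p q
        rw [dist_self_add_left] at h6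
        linarith [Metric.mem_ball.1 hp]
    rw [h1, hmv, smul_smul, inv_mul_cancel₀ hκ.ne', one_smul]
  have hrepr' : ∀ p ∈ Metric.ball q r, F p =
      κ⁻¹ • convolution (B.indicator F) η L (lebesgueH m) p := fun p hp => by
    have hpU : p ∈ U := hrU (Metric.closedBall_subset_closedBall (by linarith)
      (Metric.ball_subset_closedBall hp))
    refine tendsto_nhds_unique (hlim p hpU) ?_
    have h1 := (hconv (fun z => η (p - z)) (hη.continuous.comp (by fun_prop))
      ⟨1, fun z => by rw [Real.norm_of_nonneg (hηn _)]; exact hη1 _⟩).const_smul κ⁻¹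
    exact h1.congr fun k => (hrepr k p hp).symm
  have hnear : ∀ᶠ p in 𝓝 q, p ∈ Metric.ball q r := Metric.ball_mem_nhds q hr
  have hev : F =ᶠ[𝓝 q] fun p => κ⁻¹ • convolution (B.indicator F) η L (lebesgueH m) p :=
    hnear.mono hrepr'
  have hevk : ∀ k, Fs k =ᶠ[𝓝 q] fun p =>
      κ⁻¹ • convolution (B.indicator (Fs k)) η L (lebesgueH m) p := fun k => hnear.mono (hrepr k)
  have hcd : ∀ f : HVec m → ℍ, LocallyIntegrable f (lebesgueH m) →
      ContDiff ℝ 1 (convolution f η L (lebesgueH m)) := fun f hf =>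
    hηc.contDiff_convolution_right (n := 1) L hf hη
  have hfd : ∀ f : HVec m → ℍ, LocallyIntegrable f (lebesgueH m) → ∀ u,
      fderiv ℝ (fun p => κ⁻¹ • convolution f η L (lebesgueH m) p) q u =
        κ⁻¹ • ∫ z, fderiv ℝ η (q - z) u • f z ∂(lebesgueH m) := fun f hf u => by
    have h1 := (hηc.hasFDerivAt_convolution_right L hf hη q).const_smul κ⁻¹
    rw [show (fun p => κ⁻¹ • convolution f η L (lebesgueH m) p) =
      κ⁻¹ • convolution f η L (lebesgueH m) from rfl, h1.fderiv, _root_.smul_apply,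
      convolution_precompR_apply L hf (hηc.fderiv ℝ) (hη.continuous_fderiv one_ne_zero)]
    rfl
  refine ⟨((hcd _ hint').const_smul κ⁻¹).contDiffAt.congr_of_eventuallyEq hev, fun u => ?_⟩
  rw [hev.fderiv_eq, hfd _ hint']
  have hηd : Continuous fun y => fderiv ℝ η y u :=
    (hη.continuous_fderiv one_ne_zero).clm_apply continuous_const
  have hηdc : HasCompactSupport fun y => fderiv ℝ η y u := hηc.fderiv_apply ℝ u
  obtain ⟨K, hK⟩ := hηd.bounded_above_of_compact_support hηdc
  refine ((hconv (fun z => fderiv ℝ η (q - z) u) (hηd.comp (by fun_prop))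
    ⟨K, fun z => hK _⟩).const_smul κ⁻¹).congr fun k => ?_
  rw [(hevk k).fderiv_eq, hfd _ (hint k)]

theorem eLpNorm_vertTranslate_sub_le (hF : MemHardy F) (hG : MemHardy G) {f g : Lp ℍ 2 (beta m)}
    (hf : IsBoundaryValue F f) (hg : IsBoundaryValue G g) {t : ℝ} (ht : 0 < t) :
    eLpNorm (fun q => vertTranslate F t q - vertTranslate G t q) 2 (beta m) ≤ ‖f - g‖ₑ := by
  have h := eLpNorm_vertTranslate_le (hF.sub hG) (hf.sub hF hG hg) ht
  rw [Lp.enorm_def, eLpNorm_congr_ae (Lp.coeFn_sub f g)]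
  exact h

theorem ae_beta_add_mem_siegel {t : ℝ} (ht : 0 < t) :
    ∀ᵐ q ∂(beta m), q + Pi.single 0 (t : ℍ) ∈ siegel m := by
  rw [beta, (measurableEmbedding_boundaryParam m).ae_map_iff]
  exact Eventually.of_forall fun v => heightPoint_mem v ht

/-- Boundary values of Hardy functions form a closed subset of `L^2`. -/
theorem exists_hardy_of_tendsto {Fs : ℕ → HVec m → ℍ} (hFs : ∀ k, MemHardy (Fs k))
    {gs : ℕ → Lp ℍ 2 (beta m)} (hgs : ∀ k, IsBoundaryValue (Fs k) (gs k)) {g : Lp ℍ 2 (beta m)}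
    (hg : Tendsto gs atTop (𝓝 g)) : ∃ F, MemHardy F ∧ IsBoundaryValue F g := by
  have hloc : ∀ q ∈ siegel m, ∃ r > 0, Metric.closedBall q (4 * r) ⊆ siegel m ∧ ∃ C : NNReal,
      (∀ k, ∀ p ∈ Metric.closedBall q (2 * r), ‖Fs k p‖ ≤ C * ‖gs k‖) ∧
      ∀ k j, ‖Fs k q - Fs j q‖ ≤ C * ‖gs k - gs j‖ := fun q hq => by
    obtain ⟨r, hr, hrU, C, hC⟩ := exists_local_bound hq
    have hconv : ∀ (x : ℍ) (y : Lp ℍ 2 (beta m)), ‖x‖ₑ ≤ C * ‖y‖ₑ → ‖x‖ ≤ C * ‖y‖ :=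
      fun x y h => by
        have h' := ENNReal.toReal_mono (by finiteness) h
        simpa using h'
    refine ⟨r, hr, hrU, C, fun k p hp => hconv _ _ ?_, fun k j => hconv _ _ ?_⟩
    · rw [Lp.enorm_def]
      exact hC _ (hFs k).1 _ (fun t ht => eLpNorm_vertTranslate_le (hFs k) (hgs k) ht) p hp
    · exact hC _ ((hFs k).sub (hFs j)).1 _
        (fun t ht => eLpNorm_vertTranslate_sub_le (hFs k) (hFs j) (hgs k) (hgs j) ht) q
        (Metric.mem_closedBall_self (by positivity))
  have hcauchy : ∀ q, ∃ x, q ∈ siegel m → Tendsto (fun k => Fs k q) atTop (𝓝 x) := fun q => by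
    by_cases hq : q ∈ siegel m
    · obtain ⟨-, -, -, C, -, hC⟩ := hloc q hq
      have h0 : Tendsto (fun n : ℕ × ℕ => (C : ℝ) * ‖gs n.1 - gs n.2‖) atTop (𝓝 0) := by
        have h1 := (cauchySeq_iff_tendsto_dist_atTop_0.1 hg.cauchySeq).const_mul (C : ℝ)
        rw [mul_zero] at h1
        exact h1.congr fun n => by rw [dist_eq_norm]
      have h2 : CauchySeq fun k => Fs k q := by
        rw [cauchySeq_iff_tendsto_dist_atTop_0]
        refine squeeze_zero (fun _ => dist_nonneg) (fun n => ?_) h0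
        rw [dist_eq_norm]
        exact hC n.1 n.2
      obtain ⟨x, hx⟩ := cauchySeq_tendsto_of_complete h2
      exact ⟨x, fun _ => hx⟩
    · exact ⟨0, fun h => (hq h).elim⟩
  choose F hF using hcauchy
  obtain ⟨A, hA⟩ := hg.norm.bddAbove_range
  have hA' : ∀ k, ‖gs k‖ ≤ A := fun k => hA ⟨k, rfl⟩
  have hreg : IsRegularOn F (siegel m) := by
    refine isRegularOn_of_tendsto (isOpen_siegel m) (fun k => (hFs k).1) hF fun q hq => ?_
    obtain ⟨r, hr, hrU, C, hC, -⟩ := hloc q hq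
    refine ⟨r, hr, hrU, C * A, fun k p hp => (hC k p hp).trans ?_⟩
    gcongr
    exact hA' k
  have hgn : Tendsto (fun k => ‖gs k‖ₑ) atTop (𝓝 ‖g‖ₑ) := hg.enorm
  have hhardy : MemHardy F := by
    refine memHardy_iff.2 ⟨hreg, ‖g‖₊, fun t ht => ?_⟩
    -- Fatou on each level, using pointwise convergence inside the domain.
    have hfat := Lp.eLpNorm_lim_le_liminf_eLpNorm (p := 2) (f := fun k => vertTranslate (Fs k) t)
      (fun k => ((hFs k).memLp ht).1) (vertTranslate F t)
      ((ae_beta_add_mem_siegel ht).mono fun q hq => hF _ hq)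
    refine hfat.trans (le_trans (liminf_le_liminf (Eventually.of_forall fun k => ?_))
      hgn.liminf_eq.le)
    rw [Lp.enorm_def]
    exact eLpNorm_vertTranslate_le (hFs k) (hgs k) ht
  refine ⟨F, hhardy, (isBoundaryValue_iff hhardy (Lp.memLp g)).2 ?_⟩
  rw [Lp.toLp_coeFn]
  -- The bound is uniform in `t`, which permits interchanging `k → ∞` with `t → 0+` by an `ε/3`
  -- argument.
  have hdist : ∀ k t, 0 < t → dist (hardySlice hhardy t) (hardySlice (hFs k) t) ≤ dist g (gs k) := by
    intro k t ht
    rw [dist_edist, dist_edist, hardySlice_of_pos hhardy ht, hardySlice_of_pos (hFs k) ht,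
      Lp.edist_toLp_toLp]
    refine ENNReal.toReal_mono (edist_ne_top _ _) ?_
    have hfat := Lp.eLpNorm_lim_le_liminf_eLpNorm (p := 2)
      (f := fun n => vertTranslate (Fs n) t - vertTranslate (Fs k) t)
      (fun n => ((hFs n).memLp ht).1.sub ((hFs k).memLp ht).1)
      (vertTranslate F t - vertTranslate (Fs k) t)
      ((ae_beta_add_mem_siegel ht).mono fun q hq => (hF _ hq).sub_const _)
    have hl : Tendsto (fun n => ‖gs n - gs k‖ₑ) atTop (𝓝 ‖g - gs k‖ₑ) :=
      (hg.sub_const (gs k)).enorm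
    rw [edist_eq_enorm_sub]
    refine hfat.trans (le_trans (liminf_le_liminf (Eventually.of_forall fun n => ?_))
      hl.liminf_eq.le)
    exact eLpNorm_vertTranslate_sub_le (hFs n) (hFs k) (hgs n) (hgs k) ht
  rw [Metric.tendsto_nhds]
  intro ε hε
  obtain ⟨k, hk⟩ := (Metric.tendsto_nhds.1 hg (ε / 3) (by positivity)).exists
  have hk2 := (isBoundaryValue_iff (hFs k) (Lp.memLp (gs k))).1 (hgs k)
  rw [Lp.toLp_coeFn] at hk2
  filter_upwards [Metric.tendsto_nhds.1 hk2 (ε / 3) (by positivity), self_mem_nhdsWithin]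
    with t ht1 ht2
  have h1 := hdist k t ht2
  have h2 := dist_triangle4 (hardySlice hhardy t) (hardySlice (hFs k) t) (gs k) g
  rw [dist_comm] at hk
  rw [dist_comm (gs k) g] at h2
  linarith

end

/-! ### A nonzero Hardy function -/

section
open scoped ContDiff
variable {m : ℕ}

instance instStarModuleRealQuaternion : StarModule ℝ ℍ :=
  ⟨fun r a => by ext <;> simp⟩

/-- Functions of one quaternionic variable that are smooth and regular off the origin, homogeneous
of degree `-(3 + k)`, and nonzero at `1`. -/
structure IsFueterHomogeneous (k : ℕ) (G : ℍ → ℍ) : Prop where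
  smooth : ∀ σ ≠ 0, ContDiffAt ℝ ∞ G σ
  homogeneous : ∀ r : ℝ, 0 < r → ∀ σ ≠ 0, G (r • σ) = (r ^ (3 + k))⁻¹ • G σ
  regular : ∀ σ ≠ 0, fderiv ℝ G σ 1 + ∑ c, imUnit c * fderiv ℝ G σ (imUnit c) = 0
  one_ne_zero : G 1 ≠ 0

/-- The Cauchy-Fueter kernel `σ̄ / |σ|^4`. -/
theorem isFueterHomogeneous_kernel :
    IsFueterHomogeneous 0 fun σ => ((‖σ‖ ^ 2) ^ 2)⁻¹ • star σ where
  smooth σ hσ := by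
    have h1 : ContDiffAt ℝ ∞ (fun σ : ℍ => (‖σ‖ ^ 2) ^ 2) σ :=
      (contDiffAt_id.norm_sq ℝ).pow 2
    exact (h1.inv (by positivity)).smul (starL' ℝ : ℍ ≃L[ℝ] ℍ).contDiff.contDiffAt
  homogeneous r hr σ hσ := by
    have h : ‖σ‖ ≠ 0 := norm_ne_zero_iff.2 hσ
    rw [norm_smul, Real.norm_of_nonneg hr.le, star_smul, smul_smul, smul_smul, star_trivial]
    congr 1
    field_simp
  regular σ hσ := by
    have hN : ‖σ‖ ^ 2 ≠ 0 := pow_ne_zero 2 (norm_ne_zero_iff.2 hσ)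
    have h1 := (hasStrictFDerivAt_norm_sq σ).hasFDerivAt
    have h2 := ((hasDerivAt_pow 2 (‖σ‖ ^ 2)).inv (pow_ne_zero 2 hN)).comp_hasFDerivAt σ h1
    have h3 := h2.smul (starL' ℝ : ℍ ≃L[ℝ] ℍ).hasFDerivAt
    have h4 : ∀ u, fderiv ℝ (fun σ : ℍ => ((‖σ‖ ^ 2) ^ 2)⁻¹ • star σ) σ u =
        ((‖σ‖ ^ 2) ^ 2)⁻¹ • star u
          - (4 * ((‖σ‖ ^ 2) ^ 3)⁻¹) • (inner ℝ σ u : ℝ) • star σ := fun u => by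
      have h5 : (fun σ : ℍ => ((‖σ‖ ^ 2) ^ 2)⁻¹ • star σ) =
        ((fun x : ℝ => x ^ 2)⁻¹ ∘ fun σ : ℍ => ‖σ‖ ^ 2) • ⇑(starL' ℝ : ℍ ≃L[ℝ] ℍ) := rfl
      rw [h5, h3.fderiv]
      simp only [_root_.add_apply, _root_.smul_apply, ContinuousLinearMap.smulRight_apply,
        Function.comp_apply, Pi.inv_apply, coe_innerSL_apply, smul_eq_mul,
        ContinuousLinearEquiv.coe_coe, starL'_apply]
      rw [sub_eq_add_neg, ← neg_smul, smul_smul, ← neg_mul]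
      congr 2
      simp only [nsmul_eq_mul]
      field_simp
      push_cast
      ring
    -- By the product rule, differentiating `σ̄` contributes `4 / |σ|⁴` and differentiating the
    -- weight contributes `-4 σ σ̄ / |σ|⁶`; they cancel.
    have h6 : (star (1 : ℍ)) + ∑ c, imUnit c * star (imUnit c) = ((4 : ℝ) : ℍ) := by
      simp only [Fin.sum_univ_three, imUnit_zero, imUnit_one, imUnit_two]
      ext <;> simp; norm_num
    have h7 : (inner ℝ σ 1 : ℝ) • star σ + ∑ c, imUnit c * ((inner ℝ σ (imUnit c) : ℝ) • star σ) =
        ((‖σ‖ ^ 2 : ℝ) : ℍ) := by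
      have e : σ * star σ = ((‖σ‖ ^ 2 : ℝ) : ℍ) := by
        rw [Quaternion.self_mul_star, Quaternion.normSq_eq_norm_mul_self, sq]
      rw [← e]
      conv_rhs => rw [quat_eq_inner_sum σ]
      simp only [add_mul, Finset.sum_mul, smul_mul_assoc, one_mul, mul_smul_comm]
      rw [← quat_eq_inner_sum σ]
    simp only [h4, mul_sub, mul_smul_comm, Finset.sum_sub_distrib, ← Finset.smul_sum]
    simp only [mul_smul_comm] at h7
    have h8 : ∀ (x y : ℝ) (a b c d : ℍ),
        x • a - y • b + (x • c - y • d) = x • (a + c) - y • (b + d) := fun x y a b c d => by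
      simp only [smul_add]; abel
    rw [h8, h6, h7, ← Quaternion.coe_smul, ← Quaternion.coe_smul, ← Quaternion.coe_sub,
      smul_eq_mul, smul_eq_mul, show ((‖σ‖ ^ 2) ^ 2)⁻¹ * 4 - 4 * ((‖σ‖ ^ 2) ^ 3)⁻¹ * ‖σ‖ ^ 2 = 0 by
        field_simp; ring, Quaternion.coe_zero]
  one_ne_zero := by simp

/-- The operator has constant coefficients, so it commutes with `∂_1`, and differentiation lowers
the degree by one. Euler's relation gives the value `-(3 + k) G(1) ≠ 0` at `1`. -/
theorem IsFueterHomogeneous.deriv {k : ℕ} {G : ℍ → ℍ} (hG : IsFueterHomogeneous k G) :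
    IsFueterHomogeneous (k + 1) fun σ => fderiv ℝ G σ 1 where
  smooth σ hσ := ((hG.smooth σ hσ).fderiv_right (m := ∞) (by simp)).clm_apply contDiffAt_const
  homogeneous r hr σ hσ := by
    have hd : ∀ τ ≠ 0, DifferentiableAt ℝ G τ := fun τ hτ =>
      (hG.smooth τ hτ).differentiableAt (by simp)
    have h1 : (fun τ => G (r • τ)) =ᶠ[𝓝 σ] fun τ => (r ^ (3 + k))⁻¹ • G τ := by
      filter_upwards [isOpen_ne.mem_nhds hσ] with τ hτ using hG.homogeneous r hr τ hτ
    have h2 := DFunLike.congr_fun (h1.fderiv_eq (𝕜 := ℝ)) 1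
    rw [fderiv_comp_smul, fderiv_fun_const_smul (hd σ hσ) ((r ^ (3 + k))⁻¹), _root_.smul_apply,
      _root_.smul_apply] at h2
    calc fderiv ℝ G (r • σ) 1 = r⁻¹ • r • fderiv ℝ G (r • σ) 1 := by
          rw [smul_smul, inv_mul_cancel₀ hr.ne', one_smul]
      _ = _ := by
          rw [h2, smul_smul]
          congr 1
          rw [← mul_inv, ← add_assoc, pow_succ, mul_comm]
  regular σ hσ := by
    have hd2 : DifferentiableAt ℝ (fderiv ℝ G) σ :=
      ((hG.smooth σ hσ).fderiv_right (m := ∞) (by simp)).differentiableAt (by simp)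
    have hsymm := ((hG.smooth σ hσ).isSymmSndFDerivAt (n := ∞)
      (by rw [minSmoothness_of_isRCLikeNormedField]; exact WithTop.coe_le_coe.2 le_top)).eq
    have h1 : ∀ u w, fderiv ℝ (fun τ => fderiv ℝ G τ w) σ u = fderiv ℝ (fderiv ℝ G) σ u w :=
      fun u w => by
        rw [fderiv_clm_apply hd2 (differentiableAt_const w)]
        simp
    have hdw : ∀ w, HasFDerivAt (fun τ => fderiv ℝ G τ w)
        (fderiv ℝ (fun τ => fderiv ℝ G τ w) σ) σ := fun w =>
      (hd2.clm_apply (differentiableAt_const w)).hasFDerivAt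
    have h2 := (hdw 1).add (HasFDerivAt.fun_sum (u := Finset.univ)
      fun c _ => (hdw (imUnit c)).const_mul (imUnit c))
    have h3 : (fun τ => fderiv ℝ G τ 1 + ∑ c, imUnit c * fderiv ℝ G τ (imUnit c)) =ᶠ[𝓝 σ]
        fun _ => 0 := by
      filter_upwards [isOpen_ne.mem_nhds hσ] with τ hτ using hG.regular τ hτ
    have h4 := h3.fderiv_eq (𝕜 := ℝ)
    have h5 := h2.fderiv
    have h6 := DFunLike.congr_fun (h5.symm.trans h4) 1
    simp only [h1]
    simpa [h1, hsymm 1] using h6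
  one_ne_zero := by
    have hd : DifferentiableAt ℝ G ((1 : ℝ) • (1 : ℍ)) := by
      rw [one_smul]
      exact (hG.smooth 1 _root_.one_ne_zero).differentiableAt (by simp)
    have h1 : HasDerivAt (fun r : ℝ => G (r • (1 : ℍ))) (fderiv ℝ G ((1 : ℝ) • (1 : ℍ)) 1) 1 := by
      have h := (hasDerivAt_id (1 : ℝ)).smul_const (1 : ℍ)
      rw [one_smul] at h
      exact hd.hasFDerivAt.comp_hasDerivAt (1 : ℝ) h
    have h2 : HasDerivAt (fun r : ℝ => (r ^ (3 + k))⁻¹ • G 1) (-(3 + k : ℝ) • G 1) 1 := by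
      have h := (hasDerivAt_pow (3 + k) (1 : ℝ)).inv (by simp)
      have h' := h.smul_const (G 1)
      convert! h' using 2
      simp
    have h3 : (fun r : ℝ => G (r • (1 : ℍ))) =ᶠ[𝓝 1] fun r : ℝ => (r ^ (3 + k))⁻¹ • G 1 := by
      filter_upwards [lt_mem_nhds one_pos] with r hr using
        hG.homogeneous r hr 1 _root_.one_ne_zero
    have h4 := h1.unique (h2.congr_of_eventuallyEq h3)
    rw [one_smul] at h4
    rw [h4]
    exact smul_ne_zero (neg_ne_zero.2 (by positivity)) hG.one_ne_zero

theorem exists_isFueterHomogeneous (k : ℕ) : ∃ G, IsFueterHomogeneous k G := by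
  induction k with
  | zero => exact ⟨_, isFueterHomogeneous_kernel⟩
  | succ k ih =>
    obtain ⟨G, hG⟩ := ih
    exact ⟨_, hG.deriv⟩

theorem IsFueterHomogeneous.exists_bound {k : ℕ} {G : ℍ → ℍ} (hG : IsFueterHomogeneous k G) :
    ∃ C, 0 ≤ C ∧ ∀ σ ≠ 0, ‖G σ‖ ≤ C * (‖σ‖ ^ (3 + k))⁻¹ := by
  have hne : ∀ σ ∈ Metric.sphere (0 : ℍ) 1, σ ≠ 0 := fun σ hσ h => by
    rw [h] at hσ; simp at hσ
  obtain ⟨C, hC⟩ := (isCompact_sphere (0 : ℍ) 1).exists_bound_of_continuousOn (f := G)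
    fun σ hσ => (hG.smooth σ (hne σ hσ)).continuousAt.continuousWithinAt
  refine ⟨|C|, abs_nonneg C, fun σ hσ => ?_⟩
  have hn : 0 < ‖σ‖ := norm_pos_iff.2 hσ
  have h1 : ‖σ‖⁻¹ • σ ∈ Metric.sphere (0 : ℍ) 1 := by
    rw [mem_sphere_zero_iff_norm, norm_smul, norm_inv, norm_norm, inv_mul_cancel₀ hn.ne']
  have h2 := hG.homogeneous ‖σ‖ hn _ (hne _ h1)
  rw [smul_smul, mul_inv_cancel₀ hn.ne', one_smul] at h2
  rw [h2, norm_smul, Real.norm_of_nonneg (by positivity), mul_comm]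
  gcongr
  exact (hC _ h1).trans (le_abs_self C)

/-- The real part of `q_1 + 1` is `|q'|² + t + 1`, which dominates `1` and, as `2|x| ≤ x² + 1`, the
coordinates of `q'`; the imaginary part dominates the rest. The estimate is uniform in `t`. -/
theorem one_add_norm_le {v : HeisCoord m} {t : ℝ} (ht : 0 < t) :
    1 + ‖v‖ ≤ 2 * ‖heightPoint v t 0 + 1‖ := by
  have hh : 0 ≤ heisHeight v := by unfold heisHeight; positivity
  have hσ : heightPoint v t 0 + 1 = quat (heisHeight v + t + 1) (v.1 0) (v.1 1) (v.1 2) := by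
    rw [heightPoint_eq, coordCLE_apply]
    ext <;> simp
  have hsq := quat_norm_sq (heisHeight v + t + 1) (v.1 0) (v.1 1) (v.1 2)
  rw [← hσ] at hsq
  set N := ‖heightPoint v t 0 + 1‖ with hN
  have hN0 : 0 ≤ N := norm_nonneg _
  have h1 : heisHeight v + 1 ≤ N := by
    refine abs_le_of_sq_le_sq' ?_ hN0 |>.2
    nlinarith [sq_nonneg (v.1 0), sq_nonneg (v.1 1), sq_nonneg (v.1 2)]
  have h2 : ‖v‖ ≤ N := by
    refine max_le ((pi_norm_le_iff_of_nonneg hN0).2 fun i => ?_)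
      ((pi_norm_le_iff_of_nonneg hN0).2 fun l => (pi_norm_le_iff_of_nonneg hN0).2 fun a => ?_)
    · refine abs_le_of_sq_le_sq ?_ hN0
      fin_cases i <;> simp only [Fin.zero_eta, Fin.mk_one, Fin.reduceFinMk] <;>
        nlinarith [sq_nonneg (v.1 0), sq_nonneg (v.1 1), sq_nonneg (v.1 2)]
    · have h3 : v.2 l a ^ 2 ≤ heisHeight v :=
        (Finset.single_le_sum (f := fun a => v.2 l a ^ 2) (fun _ _ => sq_nonneg _)
          (Finset.mem_univ a)).trans
        (Finset.single_le_sum (f := fun l => ∑ a, v.2 l a ^ 2)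
          (fun _ _ => Finset.sum_nonneg fun _ _ => sq_nonneg _) (Finset.mem_univ l))
      rw [Real.norm_eq_abs]
      nlinarith [sq_abs (v.2 l a), sq_nonneg (|v.2 l a| - 1)]
  linarith

theorem isRegularOn_comp_add_one {k : ℕ} {G : ℍ → ℍ} (hG : IsFueterHomogeneous k G) :
    IsRegularOn (fun q : HVec m => G (q 0 + 1)) (siegel m) := by
  have hne : ∀ q ∈ siegel m, q 0 + 1 ≠ 0 := fun q hq h => by
    have h1 : 0 ≤ tailNormSq q := by unfold tailNormSq; positivity
    have h2 : tailNormSq q < (q 0).re := hq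
    have h3 := congrArg (fun a : ℍ => a.re) h
    simp at h3
    linarith
  have haff : ContDiff ℝ ∞ fun q : HVec m => q 0 + 1 := (contDiff_apply ℝ ℍ 0).add contDiff_const
  refine ⟨fun q hq => (((hG.smooth _ (hne q hq)).comp q haff.contDiffAt).of_le
    (by simp)).contDiffWithinAt, fun l q hq => ?_⟩
  have h1 : HasFDerivAt (fun q : HVec m => q 0 + 1)
      (ContinuousLinearMap.proj (R := ℝ) (φ := fun _ : Fin (m + 1) => ℍ) 0) q :=
    (ContinuousLinearMap.proj (R := ℝ) (φ := fun _ : Fin (m + 1) => ℍ) 0).hasFDerivAt.add_const 1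
  have h2 := ((hG.smooth _ (hne q hq)).differentiableAt (by simp)).hasFDerivAt.comp q h1
  rw [cauchyFueter_eq_sum, show (fun q : HVec m => G (q 0 + 1)) = G ∘ fun q => q 0 + 1 from rfl,
    h2.fderiv]
  simp only [ContinuousLinearMap.comp_apply, ContinuousLinearMap.proj_apply]
  rcases eq_or_ne l 0 with rfl | hl
  · simpa only [Pi.single_eq_same] using hG.regular _ (hne q hq)
  · simp [Pi.single_eq_of_ne hl.symm]

/-- The Hardy space contains a nonzero function. -/
theorem exists_memHardy_ne_zero (m : ℕ) :
    ∃ F : HVec m → ℍ, MemHardy F ∧ ∃ q ∈ siegel m, F q ≠ 0 := by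
  -- The decay order is `3 + 2m`; its double `6 + 4m` exceeds the dimension `3 + 4m` of the
  -- Heisenberg group, whence square integrability.
  obtain ⟨G, hG⟩ := exists_isFueterHomogeneous (2 * m)
  obtain ⟨C, hC0, hC⟩ := hG.exists_bound
  have hreg := isRegularOn_comp_add_one (m := m) hG
  refine ⟨_, memHardy_iff.2 ⟨hreg, ?_⟩, Pi.single 0 1, ?_, ?_⟩
  · set e : ℕ := 3 + 2 * m with he
    let B : HeisCoord m → ℝ := fun v => C * 2 ^ e * ((1 + ‖v‖) ^ e)⁻¹
    have hBc : Continuous B := by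
      refine continuous_const.mul (Continuous.inv₀ (by fun_prop) fun v => ?_)
      positivity
    have hB : MemLp B 2 volume := by
      rw [memLp_two_iff_integrable_sq hBc.aestronglyMeasurable]
      have hfr : (Module.finrank ℝ (HeisCoord m) : ℝ) < ((2 * e : ℕ) : ℝ) := by
        have : Module.finrank ℝ (HeisCoord m) = 3 + m * 4 := by
          simp [Module.finrank_prod, Module.finrank_pi_fintype]
        rw [this]
        norm_cast
        omega
      refine ((integrable_one_add_norm (μ := (volume : Measure (HeisCoord m))) hfr).const_mul
        ((C * 2 ^ e) ^ 2)).congr (Eventually.of_forall fun v => ?_)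
      simp only [B]
      rw [mul_pow (C * 2 ^ e), inv_pow, ← pow_mul (1 + ‖v‖), Real.rpow_neg (by positivity), Real.rpow_natCast,
        mul_comm e 2]
    refine ⟨(eLpNorm B 2 volume).toNNReal, fun t ht => ?_⟩
    rw [ENNReal.coe_toNNReal hB.2.ne, eLpNorm_vertTranslate]
    refine eLpNorm_mono_real fun v => ?_
    have h1 := one_add_norm_le (v := v) ht
    have hpos : 0 < ‖heightPoint v t 0 + 1‖ := by linarith [norm_nonneg v]
    refine (hC _ (norm_pos_iff.1 hpos)).trans ?_
    simp only [B]
    rw [mul_assoc]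
    refine mul_le_mul_of_nonneg_left ?_ hC0
    rw [← div_eq_mul_inv, inv_eq_one_div, div_le_div_iff₀ (by positivity) (by positivity), one_mul,
      ← mul_pow]
    gcongr
  · rw [mem_siegel_iff]
    simp [height, tailNormSq]
  · have h1 : (Pi.single 0 1 : HVec m) 0 + 1 = (2 : ℝ) • (1 : ℍ) := by
      rw [Pi.single_eq_same]; ext <;> simp; norm_num
    simp only [h1]
    rw [hG.homogeneous 2 two_pos 1 one_ne_zero]
    exact smul_ne_zero (by positivity) hG.one_ne_zero

end

/-! ### Riesz representation and the Cauchy–Szegő kernel -/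

section

variable {m : ℕ} {F G : HVec m → ℍ}

theorem eq_of_isBoundaryValue (hF : MemHardy F) (hG : MemHardy G) {g : Lp ℍ 2 (beta m)}
    (hFg : IsBoundaryValue F g) (hGg : IsBoundaryValue G g) {q : HVec m} (hq : q ∈ siegel m) :
    F q = G q := by
  obtain ⟨r, hr, -, C, hC⟩ := exists_local_bound hq
  have h := hC _ (hF.sub hG).1 _ (fun t ht => eLpNorm_vertTranslate_sub_le hF hG hFg hGg ht) q
    (Metric.mem_closedBall_self (by positivity))
  simpa [sub_eq_zero] using h

theorem exists_norm_eval_le {q : HVec m} (hq : q ∈ siegel m) : ∃ C : ℝ,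
    ∀ F : HVec m → ℍ, MemHardy F → ∀ g : Lp ℍ 2 (beta m), IsBoundaryValue F g →
      ‖F q‖ ≤ C * ‖g‖ := by
  obtain ⟨r, hr, -, C, hC⟩ := exists_local_bound hq
  refine ⟨C, fun F hF g hg => ?_⟩
  have h := hC _ hF.1 _ (fun t ht => eLpNorm_vertTranslate_le hF hg ht) q
    (Metric.mem_closedBall_self (by positivity))
  rw [← Lp.enorm_def] at h
  simpa using ENNReal.toReal_mono (by finiteness) h

/-- The boundary values of Hardy functions, as a real subspace of `L^2`. -/
def hardyBoundary (m : ℕ) : Submodule ℝ (Lp ℍ 2 (beta m)) where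
  carrier := {g | ∃ F, MemHardy F ∧ IsBoundaryValue F g}
  add_mem' := by
    rintro f g ⟨F, hF, hf⟩ ⟨G, hG, hg⟩
    exact ⟨_, hF.add hG, (hf.add hF hG hg).congr_ae (Lp.coeFn_add f g).symm⟩
  zero_mem' := by
    obtain ⟨F, hF, -⟩ := exists_memHardy_ne_zero m
    obtain ⟨g, hg⟩ := exists_isBoundaryValue hF
    refine ⟨_, hF.mul_const 0, (hg.mul_const 0).congr_ae ?_⟩
    filter_upwards [Lp.coeFn_zero ℍ 2 (beta m)] with q hq
    rw [hq, mul_zero, Pi.zero_apply]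
  smul_mem' := by
    rintro c f ⟨F, hF, hf⟩
    refine ⟨_, hF.mul_const (c : ℍ), (hf.mul_const (c : ℍ)).congr_ae ?_⟩
    filter_upwards [Lp.coeFn_smul c f] with q hq
    rw [hq, Quaternion.mul_coe_eq_smul, Pi.smul_apply]

theorem isClosed_hardyBoundary (m : ℕ) : IsClosed (hardyBoundary m : Set (Lp ℍ 2 (beta m))) := by
  refine IsSeqClosed.isClosed fun gs g hgs hg => ?_
  choose Fs hFs hFgs using hgs
  exact exists_hardy_of_tendsto hFs hFgs hg

/-- Riesz representation of the real part of the evaluation at a point of the domain. -/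
theorem exists_real_kernel {q : HVec m} (hq : q ∈ siegel m) :
    ∃ (K : HVec m → ℍ) (k : Lp ℍ 2 (beta m)), MemHardy K ∧ IsBoundaryValue K k ∧
      ∀ F : HVec m → ℍ, MemHardy F → ∀ g : Lp ℍ 2 (beta m), IsBoundaryValue F g →
        (F q).re = inner ℝ k g := by
  have : CompleteSpace (hardyBoundary m) :=
    (isClosed_hardyBoundary m).completeSpace_coe
  choose ext hext hextb using fun g : hardyBoundary m => g.2
  obtain ⟨C, hC⟩ := exists_norm_eval_le hq
  -- The extension `ext` is merely chosen; its value at `q` is determined by the boundary value, and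
  -- this makes evaluation linear.
  have hev : ∀ F : HVec m → ℍ, MemHardy F → ∀ g : hardyBoundary m, IsBoundaryValue F g →
      ext g q = F q := fun F hF g hg => eq_of_isBoundaryValue (hext g) hF (hextb g) hg hq
  let ev : hardyBoundary m →ₗ[ℝ] ℝ :=
    { toFun := fun g => (ext g q).re
      map_add' := fun f g => by
        rw [hev _ ((hext f).add (hext g)) (f + g) (((hextb f).add (hext f) (hext g)
          (hextb g)).congr_ae (Lp.coeFn_add _ _).symm), Quaternion.re_add]
      map_smul' := fun c f => by
        rw [hev _ ((hext f).mul_const (c : ℍ)) (c • f) (((hextb f).mul_const (c : ℍ)).congr_ae ?_),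
          Quaternion.mul_coe_eq_smul, Quaternion.re_smul, RingHom.id_apply]
        filter_upwards [Lp.coeFn_smul c (f : Lp ℍ 2 (beta m))] with x hx
        rw [Submodule.coe_smul, hx, Quaternion.mul_coe_eq_smul, Pi.smul_apply] }
  have hre : ∀ a : ℍ, ‖a.re‖ ≤ ‖a‖ := fun a => by
    have h := abs_real_inner_le_norm a 1
    simpa [Quaternion.inner_def] using h
  let evL : StrongDual ℝ (hardyBoundary m) :=
    ev.mkContinuous C fun g => (hre _).trans (hC _ (hext g) g (hextb g))
  let k := (InnerProductSpace.toDual ℝ (hardyBoundary m)).symm evL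
  refine ⟨ext k, k, hext k, hextb k, fun F hF g hg => ?_⟩
  have h := InnerProductSpace.toDual_symm_apply (𝕜 := ℝ) (x := (⟨g, F, hF, hg⟩ : hardyBoundary m))
    (y := evL)
  rw [Submodule.coe_inner] at h
  rw [h, ← hev F hF ⟨g, F, hF, hg⟩ hg]
  rfl

theorem integrable_star_mul {α : Type*} [MeasurableSpace α] {μ : Measure α} {f g : α → ℍ}
    (hf : MemLp f 2 μ) (hg : MemLp g 2 μ) : Integrable (fun x => star (f x) * g x) μ :=
  MemLp.integrable_mul (p := 2) (q := 2) hf.star hg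

theorem integral_star_quat {α : Type*} [MeasurableSpace α] {μ : Measure α} (f : α → ℍ) :
    ∫ x, star (f x) ∂μ = star (∫ x, f x ∂μ) :=
  (starL' ℝ : ℍ ≃L[ℝ] ℍ).integral_comp_comm f

/-- The reproducing functions of the Hardy space. -/
theorem exists_kernel {q : HVec m} (hq : q ∈ siegel m) :
    ∃ K k : HVec m → ℍ, MemHardy K ∧ IsBoundaryValue K k ∧
      ∀ F : HVec m → ℍ, MemHardy F → ∀ g : HVec m → ℍ, IsBoundaryValue F g →
        F q = ∫ Q, star (k Q) * g Q ∂(beta m) := by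
  obtain ⟨K, k, hK, hk, h⟩ := exists_real_kernel hq
  refine ⟨K, k, hK, hk, fun F hF g hg => ext_inner_left ℝ fun d => ?_⟩
  rw [← integral_inner (integrable_star_mul hk.1 hg.1)]
  have hgd := hg.mul_const (star d)
  -- Since `⟨d, F(q)⟩ = Re(F(q) d̄)`, the real formula applied to `F d̄` gives the component of
  -- `F(q)` along an arbitrary `d`.
  have h1 := h _ (hF.mul_const (star d)) (hgd.1.toLp _) (hgd.congr_ae hgd.1.coeFn_toLp.symm)
  have h2 : inner ℝ d (F q) = (F q * star d).re := by
    rw [real_inner_comm, Quaternion.inner_def]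
  rw [h2, h1, L2.inner_def]
  refine integral_congr_ae ?_
  filter_upwards [hgd.1.coeFn_toLp] with Q hQ
  rw [hQ]
  simp only [Quaternion.inner_def]
  simp
  ring

/-- Conjugation is isometric, so it respects `L²` limits although it does not preserve left
regularity. It supplies the boundary values of the kernel in its second variable. -/
theorem IsBoundaryValue.star {f : HVec m → ℍ} (hf : IsBoundaryValue F f) :
    IsBoundaryValue (fun q => star (F q)) (fun q => star (f q)) := by
  refine ⟨hf.1.star, hf.2.congr fun t => eLpNorm_congr_norm_ae (Eventually.of_forall fun q => ?_)⟩
  rw [← norm_star]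
  simp only [star_sub, vertTranslate]

theorem IsBoundaryValue.congr {f : HVec m → ℍ} (hf : IsBoundaryValue F f)
    (h : ∀ q ∈ siegel m, F q = G q) : IsBoundaryValue G f := by
  refine ⟨hf.1, hf.2.congr' ?_⟩
  filter_upwards [self_mem_nhdsWithin] with t ht
  refine eLpNorm_congr_ae ((ae_beta_add_mem_siegel ht).mono fun q hq => ?_)
  simp only [vertTranslate, h _ hq]

theorem exists_cauchySzegoKernel (m : ℕ) : ∃ S : HVec m → HVec m → ℍ,
    IsCauchySzegoKernel S ∧
    (∀ p ∈ siegel m, ∃ g, IsBoundaryValue (fun q => S q p) g) ∧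
    (∀ q ∈ siegel m, ∃ g, IsBoundaryValue (fun p => S q p) g) ∧
    ∀ S' : HVec m → HVec m → ℍ, IsCauchySzegoKernel S' →
      ∀ q ∈ siegel m, ∀ p ∈ siegel m, S' q p = S q p := by
  choose! K k hK hk hrep using fun (q : HVec m) (hq : q ∈ siegel m) => exists_kernel hq
  -- Reproducing `K p` at `q` and `K q` at `p` gives the integrals of `k̄_q k_p` and `k̄_p k_q`,
  -- which are conjugate.
  have hsymm : ∀ q ∈ siegel m, ∀ p ∈ siegel m, K p q = star (K q p) := fun q hq p hp => by
    rw [hrep q hq _ (hK p hp) _ (hk p hp), hrep p hp _ (hK q hq) _ (hk q hq),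
      ← integral_star_quat]
    simp only [star_mul, star_star]
  have hb : ∀ q ∈ siegel m, IsBoundaryValue (fun p => K p q) (fun Q => star (k q Q)) :=
    fun q hq => (hk q hq).star.congr fun p hp => (hsymm q hq p hp).symm
  refine ⟨fun q p => K p q, ⟨fun p hp => hK p hp, hsymm, fun F hF q hq Fb Sb hFb hSb => ?_⟩,
    fun p hp => ⟨_, hk p hp⟩, fun q hq => ⟨_, hb q hq⟩, fun S' hS' q hq p hp => ?_⟩
  · have h1 : IsBoundaryValue (K q) (fun Q => star (Sb Q)) :=
      hSb.star.congr fun p hp => by rw [hsymm q hq p hp, star_star]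
    have h2 : (fun Q => star (k q Q) * Fb Q) =ᵐ[beta m] fun Q => Sb Q * Fb Q := by
      filter_upwards [h1.ae_unique (hK q hq) (hk q hq)] with Q hQ
      rw [← hQ, star_star]
    exact ⟨(integrable_star_mul (hk q hq).1 hFb.1).congr h2,
      (hrep q hq F hF Fb hFb).trans (integral_congr_ae h2)⟩
  -- Uniqueness: `S'` reproduces `K q` at `p`, while `K` reproduces `S'(·, p)` at `q`; the two
  -- integrals are conjugate.
  · obtain ⟨b, hbv⟩ := exists_isBoundaryValue (hS'.mem_hardy p hp)
    have h1 : IsBoundaryValue (fun x => S' p x) (fun Q => star (b Q)) :=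
      hbv.star.congr fun x hx => (hS'.symm p hp x hx).symm
    have h2 := (hS'.reproducing (K q) (hK q hq) p hp _ _ (hk q hq) h1).2
    change S' q p = K p q
    rw [hsymm q hq p hp, h2, ← integral_star_quat]
    simp only [star_mul, star_star]
    exact hrep q hq _ (hS'.mem_hardy p hp) b hbv

end

end QuatSiegel

end

theorem mainTheorem3 (m : ℕ) :
    -- boundary values of functions in the Hardy space exist and are unique almost everywhere
    (∀ F : HVec m → ℍ, MemHardy F →
      (∃ Fb, IsBoundaryValue F Fb) ∧
      ∀ Fb Fb', IsBoundaryValue F Fb → IsBoundaryValue F Fb' →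
        Fb =ᵐ[beta m] Fb') ∧
    -- existence and uniqueness of the kernel, with its boundary values in both variables
    (∃ S : HVec m → HVec m → ℍ,
      IsCauchySzegoKernel S ∧
      (∀ p ∈ siegel m, ∃ g, IsBoundaryValue (fun q => S q p) g) ∧
      (∀ q ∈ siegel m, ∃ g, IsBoundaryValue (fun p => S q p) g) ∧
      ∀ S' : HVec m → HVec m → ℍ,
        IsCauchySzegoKernel S' →
        ∀ q ∈ siegel m, ∀ p ∈ siegel m, S' q p = S q p) ∧
    -- the Hardy space is nontrivial
    (∃ F : HVec m → ℍ, MemHardy F ∧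
      ∃ q ∈ siegel m, F q ≠ 0) := by
  exact ⟨fun F hF => ⟨exists_isBoundaryValue hF, fun Fb Fb' h h' => h.ae_unique hF h'⟩,
    exists_cauchySzegoKernel m, exists_memHardy_ne_zero m⟩
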